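/- **Setting.** Let $X\subseteq\mathbb R^d$ be closed and convex, let $h$ be a convex function with domain $\mathrm{dom}(h)\subseteq\mathbb R^m$, and let $g:X\to\mathbb R$ and $\ell:X\to\mathbb R^m$ be differentiable. Put $f(x,y)=g(x)+h(y)-\langle y,\ell(x)\rangle$, and consider $\min_{x\in X}F(x)$ with $F(x)=\inf_{y\in\mathrm{dom}(h)}f(x,y)$. Here $\partial F$ is the limiting subdifferential of $F$ extended by $+\infty$ outside $X$, and norms are Euclidean or spectral norms. Assume that * $\nabla g$ is $L_g$-Lipschitz on $X$; $\|\nabla\ell\|\le G_\ell$ on $X$, and $\nabla\ell$ is $L_\ell$-Lipschitz on $X$; $\|y\|\le D_y$ on $\mathrm{dom}(h)$; * the conjugate $h^*$ is differentiable with $\|\nabla h^*(s)-\nabla h^*(s')\|\le L_h\|s-s'\|^v$ for all $s,s'$, where $v\in(0,1]$; * $f(x,y)-f(x',y')\le M$ for all $x,x'\in X$ and $y,y'\in\mathrm{dom}(h)$; * for a random sample $\xi$, the stochastic quantities $\nabla g(x;\xi)$, $\ell(x;\xi)$, $\nabla\ell(x;\xi)$ are unbiased estimators of $\nabla g(x)$,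 $\ell(x)$, $\nabla\ell(x)$, each with variance at most $\sigma^2$, for every $x\in X$. Let $L=\sqrt{\max(2L_g^2+4L_\ell^2D_y^2+G_\ell^2,\,4G_\ell^2)}>0$, $\eta=c/L$ with $0<c<\frac12$, and mini-batch sizes $m_t=bt$ with an integer $b\ge1$. MSPG starts at $x_1\in X$, $y_1\in\mathrm{dom}(h)$; for $t=1,\dots,T$ it draws i.i.d. samples $\xi_{t,1},\dots,\xi_{t,m_t}$, independent of the past, and sets $$x_{t+1}=\Pi_X\Big[x_t-\frac{\eta}{m_t}\sum_{i=1}^{m_t}\big(\nabla g(x_t;\xi_{t,i})-\nabla\ell(x_t;\xi_{t,i})^\top y_t\big)\Big],$$ $$y_{t+1}=\mathrm{argmin}_{y\in\mathrm{dom}(h)}\ h(y)+\frac1{2\eta}\Big\|y-y_t-\frac{\eta}{m_t}\sum_{i=1}^{m_t}\ell(x_t;\xi_{t,i})\Big\|^2 .$$ The output is $x_\tau$, where $\tau\in\{1,\dots,T\}$ is drawn independently of the samples with $P(\tau=t)=t^\alpha/\sum_{s=1}^Ts^\alpha$ for a fixed $\alpha\ge0$ ($\alpha=0$ is uniform sampling).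 **Theorem.** Let $B\ge\mathrm{dist}(0,\partial F(x_1))$. There is a constant $C>0$, depending only on $L_g,G_\ell,L_\ell,D_y,L_h,v,M,\sigma,B,c,b,\alpha$, such that for all $T\ge1$, with $\mathrm{dist}(0,\partial F(x_\tau))$ being measurable, $$\mathrm E\big[\mathrm{dist}(0,\partial F(x_\tau))^2\big]\le\frac{C}{T^v}\quad\text{if } v<1 \text{ or } \alpha>0,$$ and in the remaining case ($v=1$ and $\alpha=0$) $$\mathrm E\big[\mathrm{dist}(0,\partial F(x_\tau))^2\big]\le\frac{C(1+\log T)}{T}.$$ Moreover, for all $v\in(0,1]$ and $\alpha\ge0$: for every $\epsilon\in(0,1]$ there is an integer $1\le N(\epsilon)\le C\epsilon^{-2/v}$, depending only on $\epsilon$ and the same parameters, with total number of samples $\sum_{t=1}^{N(\epsilon)}m_t\le C\epsilon^{-4/v}$, such that $\mathrm E[\mathrm{dist}(0,\partial F(x_\tau))]\le\epsilon$ whenever $T\ge N(\epsilon)$. -/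

import Mathlib

open MeasureTheory ProbabilityTheory Filter Topology
open scoped ENNReal

noncomputable section

namespace InfProj

/-- `ℝⁿ` with the Euclidean norm. -/
abbrev Vec (n : ℕ) := EuclideanSpace ℝ (Fin n)

/-- The data of an inf-projection problem
`min_{x ∈ X} F(x)`, `F(x) = g(x) + min_{y ∈ dom h} (h(y) - ⟪y, ℓ(x)⟫)`.
Values of `g`, `ℓ` outside `X`, and of `h` outside `domH`, play no role. -/
structure Problem (d m : ℕ) where
  /-- the feasible set -/
  X : Set (Vec d)
  /-- the domain of `h` -/
  domH : Set (Vec m)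
  g : Vec d → ℝ
  /-- the gradient of `g` on `X` -/
  gradG : Vec d → Vec d
  l : Vec d → Vec m
  /-- the Jacobian of `ℓ` on `X` -/
  jacL : Vec d → (Vec d →L[ℝ] Vec m)
  h : Vec m → ℝ

namespace Problem

variable {d m : ℕ}

/-- The joint function `f(x, y) = g(x) + h(y) - ⟪y, ℓ(x)⟫`. -/
def f (P : Problem d m) (x : Vec d) (y : Vec m) : ℝ :=
  P.g x + P.h y - inner ℝ y (P.l x)

/-- The target function, the inf-projection of `f`. -/
def F (P : Problem d m) (x : Vec d) : ℝ :=
  P.g x + sInf ((fun y => P.h y - inner ℝ y (P.l x)) '' P.domH)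

/-- The convex conjugate `h*(s) = sup_{y ∈ dom h} (⟪y, s⟫ - h(y))`. -/
def conjH (P : Problem d m) (s : Vec m) : ℝ :=
  sSup ((fun y => inner ℝ y s - P.h y) '' P.domH)

/-- The conditions on the deterministic data: `g` is `Lg`-smooth, `ℓ` is `Gl`-Lipschitz and
`Ll`-smooth, `dom h` lies in the ball of radius `Dy`, `h` is convex, `h*` has
`(Lh, v)`-Hölder continuous gradient, and `f` oscillates by at most `M` on `X × dom h`. -/
structure Regular (P : Problem d m) (Lg Gl Ll Dy Lh v M : ℝ) : Prop where
  isClosed_X : IsClosed P.X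
  convex_X : Convex ℝ P.X
  hasGradient_g : ∀ x ∈ P.X, HasGradientWithinAt P.g (P.gradG x) P.X x
  smooth_g : ∀ x ∈ P.X, ∀ x' ∈ P.X, ‖P.gradG x - P.gradG x'‖ ≤ Lg * ‖x - x'‖
  hasFDeriv_l : ∀ x ∈ P.X, HasFDerivWithinAt P.l (P.jacL x) P.X x
  lipschitz_l : ∀ x ∈ P.X, ‖P.jacL x‖ ≤ Gl
  smooth_l : ∀ x ∈ P.X, ∀ x' ∈ P.X, ‖P.jacL x - P.jacL x'‖ ≤ Ll * ‖x - x'‖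
  convex_h : ConvexOn ℝ P.domH P.h
  bounded_domH : ∀ y ∈ P.domH, ‖y‖ ≤ Dy
  differentiable_conjH : Differentiable ℝ P.conjH
  holder_conjH : ∀ s s' : Vec m,
    ‖gradient P.conjH s - gradient P.conjH s'‖ ≤ Lh * ‖s - s'‖ ^ v
  oscillation_f : ∀ x ∈ P.X, ∀ y ∈ P.domH, ∀ x' ∈ P.X, ∀ y' ∈ P.domH,
    P.f x y - P.f x' y' ≤ M

end Problem

/-- The joint smoothness constant of `f₀(x, y) = g(x) - ⟪y, ℓ(x)⟫` on `X × dom h`. -/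
def jointSmoothness (Lg Gl Ll Dy : ℝ) : ℝ :=
  Real.sqrt (max (2 * Lg ^ 2 + 4 * Ll ^ 2 * Dy ^ 2 + Gl ^ 2) (4 * Gl ^ 2))

/-- The Fréchet subdifferential at `x` of the function that is `φ` on `X` and `+∞` elsewhere:
all `u` with `liminf_{x' → x} (φ x' - φ x - ⟪u, x' - x⟫) / ‖x' - x‖ ≥ 0`. -/
def frechetSubdiff {d : ℕ} (φ : Vec d → ℝ) (X : Set (Vec d)) (x : Vec d) : Set (Vec d) :=
  {u | x ∈ X ∧ ∀ ε : ℝ, 0 < ε → ∀ᶠ x' in 𝓝[X] x,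
    φ x + inner ℝ u (x' - x) - ε * ‖x' - x‖ ≤ φ x'}

/-- The limiting subdifferential at `x` of the function that is `φ` on `X` and `+∞` elsewhere. -/
def limitingSubdiff {d : ℕ} (φ : Vec d → ℝ) (X : Set (Vec d)) (x : Vec d) : Set (Vec d) :=
  {u | x ∈ X ∧ ∃ (z : ℕ → Vec d) (w : ℕ → Vec d),
    (∀ k, w k ∈ frechetSubdiff φ X (z k)) ∧
    Tendsto z atTop (𝓝 x) ∧ Tendsto (fun k => φ (z k)) atTop (𝓝 (φ x)) ∧
    Tendsto w atTop (𝓝 u)}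

/-- `dist(0, ∂F(x))` for the target function `F` on `X` (infinite if `∂F(x)` is empty). -/
def stationarity {d m : ℕ} (P : Problem d m) (x : Vec d) : ℝ≥0∞ :=
  Metric.infEDist 0 (limitingSubdiff P.F P.X x)

/-- Stochastic first-order information: `∇g(x; ξ)`, `ℓ(x; ξ)` and `∇ℓ(x; ξ)`. Independent
components `ξ = (ξ_g, ξ_ℓ)` are the special case of a product sample space. -/
structure Oracle (d m : ℕ) (Ξ : Type*) where
  gradG : Vec d → Ξ → Vec d
  l : Vec d → Ξ → Vec m
  jacL : Vec d → Ξ → (Vec d →L[ℝ] Vec m)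

namespace Oracle

variable {d m : ℕ} {Ξ : Type*}

/-- `∇ₓ f₀(x, y; ξ) = ∇g(x; ξ) - ∇ℓ(x; ξ)ᵀ y`. -/
def gradX (O : Oracle d m Ξ) (x : Vec d) (y : Vec m) (z : Ξ) : Vec d :=
  O.gradG x z - ContinuousLinearMap.adjoint (O.jacL x z) y

/-- `∇_y f₀(x, y; ξ) = -ℓ(x; ξ)`. -/
def gradY (O : Oracle d m Ξ) (x : Vec d) (_y : Vec m) (z : Ξ) : Vec m :=
  -O.l x z

/-- Under the sample distribution `ν`, the oracle is unbiased on `X`, and each of its three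
components has variance at most `σ²` there. -/
structure IsUnbiased [MeasurableSpace Ξ] (O : Oracle d m Ξ) (P : Problem d m)
    (ν : Measure Ξ) (σ : ℝ) : Prop where
  measurable_gradG : Measurable (Function.uncurry O.gradG)
  measurable_l : Measurable (Function.uncurry O.l)
  measurable_jacL : Measurable (Function.uncurry O.jacL)
  integrable_gradG : ∀ x ∈ P.X, Integrable (O.gradG x) ν
  integrable_l : ∀ x ∈ P.X, Integrable (O.l x) ν
  integrable_jacL : ∀ x ∈ P.X, Integrable (O.jacL x) ν
  mean_gradG : ∀ x ∈ P.X, ∫ z, O.gradG x z ∂ν = P.gradG x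
  mean_l : ∀ x ∈ P.X, ∫ z, O.l x z ∂ν = P.l x
  mean_jacL : ∀ x ∈ P.X, ∫ z, O.jacL x z ∂ν = P.jacL x
  variance_gradG : ∀ x ∈ P.X,
    ∫⁻ z, ‖O.gradG x z - P.gradG x‖ₑ ^ 2 ∂ν ≤ ENNReal.ofReal (σ ^ 2)
  variance_l : ∀ x ∈ P.X,
    ∫⁻ z, ‖O.l x z - P.l x‖ₑ ^ 2 ∂ν ≤ ENNReal.ofReal (σ ^ 2)
  variance_jacL : ∀ x ∈ P.X,
    ∫⁻ z, ‖O.jacL x z - P.jacL x‖ₑ ^ 2 ∂ν ≤ ENNReal.ofReal (σ ^ 2)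

end Oracle

/-- `p` is the projection of `q` onto `X`. -/
def IsProjection {d : ℕ} (X : Set (Vec d)) (q p : Vec d) : Prop :=
  p ∈ X ∧ ∀ z ∈ X, ‖p - q‖ ≤ ‖z - q‖

/-- `p = argmin_{y ∈ Y} h(y) + ‖y - q‖² / (2 η)`. -/
def IsProx {m : ℕ} (h : Vec m → ℝ) (Y : Set (Vec m)) (η : ℝ) (q p : Vec m) : Prop :=
  p ∈ Y ∧ ∀ z ∈ Y, h p + 1 / (2 * η) * ‖p - q‖ ^ 2 ≤ h z + 1 / (2 * η) * ‖z - q‖ ^ 2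

/-- The average of `k` vectors (used with `k ≥ 1`). -/
def batchMean {V : Type*} [AddCommGroup V] [Module ℝ V] (k : ℕ) (a : ℕ → V) : V :=
  (k : ℝ)⁻¹ • ∑ i ∈ Finset.range k, a i

/-- `(x t, y t)` for `1 ≤ t ≤ T + 1` are the iterates of the mini-batch stochastic proximal
gradient method (MSPG) started at `(x₁, y₁)`, run for `T` iterations with step size `η` and
mini-batch sizes `batch t`; the `i`-th sample of iteration `t` is `ξ t i`. -/
structure IsMSPGRun {d m : ℕ} {Ξ Ω : Type*} (P : Problem d m) (O : Oracle d m Ξ)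
    (η : ℝ) (batch : ℕ → ℕ) (T : ℕ) (ξ : ℕ → ℕ → Ω → Ξ) (x₁ : Vec d) (y₁ : Vec m)
    (x : ℕ → Ω → Vec d) (y : ℕ → Ω → Vec m) : Prop where
  init_x : ∀ ω, x 1 ω = x₁
  init_y : ∀ ω, y 1 ω = y₁
  step_x : ∀ t ∈ Finset.Icc 1 T, ∀ ω, IsProjection P.X
    (x t ω - η • batchMean (batch t) (fun i => O.gradX (x t ω) (y t ω) (ξ t i ω))) (x (t + 1) ω)
  step_y : ∀ t ∈ Finset.Icc 1 T, ∀ ω, IsProx P.h P.domH η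
    (y t ω - η • batchMean (batch t) (fun i => O.gradY (x t ω) (y t ω) (ξ t i ω))) (y (t + 1) ω)

/-- The samples `ξ t i` are independent with common distribution `ν`. -/
structure IsSampling {Ξ Ω : Type*} [MeasurableSpace Ξ] [MeasurableSpace Ω]
    (ξ : ℕ → ℕ → Ω → Ξ) (ν : Measure Ξ) (μ : Measure Ω) : Prop where
  measurable : ∀ t i, Measurable (ξ t i)
  law : ∀ t i, Measure.map (ξ t i) μ = ν
  indep : iIndepFun (fun (p : ℕ × ℕ) => ξ p.1 p.2) μ

/-- The output index `τ ∈ {1, …, T}` is drawn independently of the samples, with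
`P(τ = t) = t^α / ∑_{s=1}^T s^α`; for `α = 0` this is the uniform distribution. -/
structure IsOutputIndex {Ξ Ω : Type*} [MeasurableSpace Ξ] [MeasurableSpace Ω]
    (τ : Ω → ℕ) (α : ℝ) (T : ℕ) (ξ : ℕ → ℕ → Ω → Ξ) (μ : Measure Ω) : Prop where
  measurable : Measurable τ
  mem : ∀ ω, τ ω ∈ Finset.Icc 1 T
  law : ∀ t ∈ Finset.Icc 1 T, μ {ω | τ ω = t} =
    ENNReal.ofReal ((t : ℝ) ^ α / ∑ s ∈ Finset.Icc 1 T, (s : ℝ) ^ α)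
  indep : IndepFun τ (fun ω (p : ℕ × ℕ) => ξ p.1 p.2 ω) μ

end InfProj

end

/-! Since `h*` is differentiable, `F = g - h* ∘ ℓ` is differentiable within `X`, and its limiting
subdifferential on the convex set `X` is `gradF x` plus the normal cone at `x`
(`mem_limitingSubdiff_iff`). MSPG is an inexact proximal gradient method for `f` in `(x, y)`
jointly, and two estimates govern one step. By `descent_step`, `f` drops by a multiple of the
squared step length, up to the squared gradient error. By `exists_mem_limitingSubdiff_step`, the
optimality condition in `y` says `y' = ∇h*(w)` with `w` close to `ℓ(x')`, so Hölder continuity turns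
near-stationarity of `f` into near-stationarity of `F`: `dist² ≲ a + a ^ v`, where `a` is the
squared step length plus the squared error.

The power is linearised by `a ^ v ≤ t ^ (1 - v) * a + t ^ (-v)`. With weights `t ^ α` and `β = α + 1
- v`, the quantity `a` then carries the increasing weight `t ^ β`. Abel summation and the
oscillation bound control the decreases of `f` by `T ^ β`, while batches of size `b * t` make the
expected error `O(1 / t)`, which contributes `∑ t ^ (β - 1)`. Hence `∑ t ^ α E[dist²] ≲ T ^ β + ∑ t
^ (β - 1)` (`exists_sum_lintegral_stationarity_sq_le`). Division by `∑ t ^ α ≳ T ^ (α + 1)` gives `T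
^ (-v)` when `β > 0`; the case `β = 0`, that is `v = 1` and `α = 0`, produces the logarithm.

First moments follow from `D ≤ r * D ^ 2 + 1 / r`. In the logarithmic case the weighted bound is
applied to the same run with `α = 1 / 2`, and `r = t ^ (1 / 2)` at time `t` removes the logarithm.
-/

namespace InfProj

/-! ### Proximal steps: optimality, nonexpansiveness, decrease -/

section Prox

variable {m : ℕ} {h : Vec m → ℝ} {Y : Set (Vec m)} {η : ℝ}

lemma nonneg_of_forall_add_mul_nonneg {A K : ℝ}
    (H : ∀ s : ℝ, 0 < s → s ≤ 1 → 0 ≤ A + s * K) : 0 ≤ A := by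
  have ht : Tendsto (fun s : ℝ => A + s * K) (𝓝[>] 0) (𝓝 (A + 0 * K)) :=
    ((continuous_const.add (continuous_id.mul continuous_const)).tendsto 0).mono_left
      nhdsWithin_le_nhds
  rw [zero_mul, add_zero] at ht
  refine ge_of_tendsto ht ?_
  filter_upwards [Ioc_mem_nhdsGT (zero_lt_one (α := ℝ))] with s hs using H s hs.1 hs.2

/-- First-order optimality: compare `p` with `p + s • (z - p)`, use convexity of `h`, divide by `s`
and let `s` tend to `0`. -/
lemma IsProx.subgradient (hh : ConvexOn ℝ Y h) (hη : 0 < η) {q p : Vec m}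
    (hp : IsProx h Y η q p) {z : Vec m} (hz : z ∈ Y) :
    h p + inner ℝ (η⁻¹ • (q - p)) (z - p) ≤ h z := by
  suffices H : 0 ≤ h z - h p - inner ℝ (η⁻¹ • (q - p)) (z - p) by linarith
  refine nonneg_of_forall_add_mul_nonneg (K := 1 / (2 * η) * ‖z - p‖ ^ 2) fun s hs0 hs1 => ?_
  have hmem := hh.1 hp.1 hz (sub_nonneg.2 hs1) hs0.le (sub_add_cancel 1 s)
  have hconv := hh.2 hp.1 hz (sub_nonneg.2 hs1) hs0.le (sub_add_cancel 1 s)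
  have hmin := hp.2 _ hmem
  have hpt : (1 - s) • p + s • z - q = s • (z - p) - (q - p) := by module
  have hnorm : ‖(1 - s) • p + s • z - q‖ ^ 2
      = s ^ 2 * ‖z - p‖ ^ 2 - 2 * s * inner ℝ (q - p) (z - p) + ‖p - q‖ ^ 2 := by
    rw [hpt, norm_sub_sq_real, norm_smul, real_inner_smul_left, real_inner_comm, norm_sub_rev q p,
      mul_pow, Real.norm_eq_abs, sq_abs]
    ring
  rw [hnorm] at hmin
  simp only [smul_eq_mul] at hconv
  rw [real_inner_smul_left]
  have key : 0 ≤ s * (h z - h p - η⁻¹ * inner ℝ (q - p) (z - p)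
      + s * (1 / (2 * η) * ‖z - p‖ ^ 2)) := by
    have e : 1 / (2 * η) * (s ^ 2 * ‖z - p‖ ^ 2 - 2 * s * inner ℝ (q - p) (z - p) + ‖p - q‖ ^ 2)
        = s * s * (1 / (2 * η) * ‖z - p‖ ^ 2) - s * (η⁻¹ * inner ℝ (q - p) (z - p))
          + 1 / (2 * η) * ‖p - q‖ ^ 2 := by
      field_simp
    rw [e] at hmin
    nlinarith
  exact nonneg_of_mul_nonneg_right key hs0

/-- Adding the subgradient inequalities at the two minimizers gives `‖p - p'‖² ≤ ⟪q - q', p - p'⟫`,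
and Cauchy–Schwarz concludes. -/
lemma IsProx.norm_sub_le (hh : ConvexOn ℝ Y h) (hη : 0 < η) {q p q' p' : Vec m}
    (hp : IsProx h Y η q p) (hp' : IsProx h Y η q' p') : ‖p - p'‖ ≤ ‖q - q'‖ := by
  have h1 := hp.subgradient hh hη hp'.1
  have h2 := hp'.subgradient hh hη hp.1
  have h3 : inner ℝ (η⁻¹ • (q - p)) (p' - p) + inner ℝ (η⁻¹ • (q' - p')) (p - p') ≤ 0 := by
    linarith
  rw [real_inner_smul_left, real_inner_smul_left, ← mul_add] at h3
  have h4 : inner ℝ (q - p) (p' - p) + inner ℝ (q' - p') (p - p') ≤ 0 :=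
    nonpos_of_mul_nonpos_right h3 (inv_pos.2 hη)
  have h5 : inner ℝ (q - p) (p' - p) + inner ℝ (q' - p') (p - p')
      = ‖p - p'‖ ^ 2 - inner ℝ (q - q') (p - p') := by
    rw [← real_inner_self_eq_norm_sq, ← neg_sub p p', inner_neg_right]
    simp only [inner_sub_left, inner_sub_right]
    ring
  have h6 := real_inner_le_norm (q - q') (p - p')
  by_contra! hlt
  nlinarith [norm_nonneg (q - q')]

/-- The proximal map agrees, wherever the minimum is attained, with a globally continuous map. -/
lemma exists_continuous_eq_of_isProx (hh : ConvexOn ℝ Y h) (hη : 0 < η) :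
    ∃ G : Vec m → Vec m, Continuous G ∧ ∀ q p, IsProx h Y η q p → p = G q := by
  classical
  let S : Set (Vec m) := {q | ∃ p, IsProx h Y η q p}
  let f : Vec m → Vec m := fun q => if H : ∃ p, IsProx h Y η q p then H.choose else 0
  have hf : ∀ q ∈ S, IsProx h Y η q (f q) := fun q hq => by
    have hq' : ∃ p, IsProx h Y η q p := hq
    simp only [f, dif_pos hq']
    exact hq'.choose_spec
  -- Existence of minimizers is not known for every `q`; the Lipschitz map on the set `S` where they
  -- exist is extended to the whole space.
  have hlip : LipschitzOnWith 1 f S := LipschitzOnWith.of_dist_le_mul fun q hq q' hq' => by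
    rw [dist_eq_norm, dist_eq_norm, NNReal.coe_one, one_mul]
    exact (hf q hq).norm_sub_le hh hη (hf q' hq')
  obtain ⟨G, hG, heq⟩ := hlip.extend_finite_dimension
  refine ⟨G, hG.continuous, fun q p hp => ?_⟩
  have hq : q ∈ S := ⟨p, hp⟩
  rw [← heq hq, ← sub_eq_zero, ← norm_le_zero_iff]
  simpa using hp.norm_sub_le hh hη (hf q hq)

lemma IsProjection.isProx {d : ℕ} {X : Set (Vec d)} {q p : Vec d} (hp : IsProjection X q p)
    (hη : 0 < η) : IsProx (fun _ => 0) X η q p :=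
  ⟨hp.1, fun z hz => by
    have := hp.2 z hz
    gcongr⟩

/-- Comparing the minimizer of a proximal step with its base point. -/
lemma IsProx.step_le (hη : 0 < η) {y G p : Vec m}
    (hp : IsProx h Y η (y - η • G) p) (hy : y ∈ Y) :
    h p + inner ℝ G (p - y) + 1 / (2 * η) * ‖p - y‖ ^ 2 ≤ h y := by
  have H := hp.2 y hy
  have e1 : p - (y - η • G) = (p - y) + η • G := by module
  have e2 : y - (y - η • G) = η • G := by module
  rw [e1, e2, norm_add_sq_real, real_inner_smul_right, real_inner_comm] at H
  have e3 : 1 / (2 * η) * (‖p - y‖ ^ 2 + 2 * (η * inner ℝ G (p - y)) + ‖η • G‖ ^ 2)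
      = 1 / (2 * η) * ‖p - y‖ ^ 2 + inner ℝ G (p - y) + 1 / (2 * η) * ‖η • G‖ ^ 2 := by
    field_simp
  linarith

end Prox

/-! ### The target function and its limiting subdifferential -/

namespace Problem

variable {d m : ℕ} {P : Problem d m}

/-- The gradient `∇g(x) - ∇ℓ(x)ᵀ y` of `f₀(·, y)`. -/
noncomputable def gradX (P : Problem d m) (x : Vec d) (y : Vec m) : Vec d :=
  P.gradG x - ContinuousLinearMap.adjoint (P.jacL x) y

/-- The gradient `∇g(x) - ∇ℓ(x)ᵀ ∇h*(ℓ(x))` of the target function on `X`. -/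
noncomputable def gradF (P : Problem d m) (x : Vec d) : Vec d :=
  P.gradX x (gradient P.conjH (P.l x))

lemma F_eq (P : Problem d m) (x : Vec d) : P.F x = P.g x - P.conjH (P.l x) := by
  have hset : (fun y => P.h y - inner ℝ y (P.l x)) '' P.domH
      = -((fun y => inner ℝ y (P.l x) - P.h y) '' P.domH) := by
    rw [← Set.image_neg_eq_neg, Set.image_image]
    simp
  rw [F, conjH, hset, Real.sInf_neg, sub_eq_add_neg]

variable {Lg Gl Ll Dy Lh v M : ℝ}

namespace Regular

variable (hP : P.Regular Lg Gl Ll Dy Lh v M)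
include hP

/-- The oscillation bound at one point of `X`, together with boundedness of `dom h`, bounds `h` from
below on `dom h`. This makes the real `sSup` in `conjH` a true supremum instead of a default value.
-/
lemma bddAbove_conjH {x : Vec d} (hx : x ∈ P.X) (s : Vec m) :
    BddAbove ((fun y => inner ℝ y s - P.h y) '' P.domH) := by
  rcases P.domH.eq_empty_or_nonempty with h0 | ⟨y₀, hy₀⟩
  · simp [h0]
  refine ⟨M - P.f x y₀ + P.g x + Dy * ‖s‖ + Dy * ‖P.l x‖, ?_⟩
  rintro _ ⟨y, hy, rfl⟩
  have h1 := hP.oscillation_f x hx y₀ hy₀ x hx y hy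
  have h2 : inner ℝ y s ≤ Dy * ‖s‖ := (real_inner_le_norm y s).trans
    (mul_le_mul_of_nonneg_right (hP.bounded_domH y hy) (norm_nonneg _))
  have h3 : -inner ℝ y (P.l x) ≤ Dy * ‖P.l x‖ :=
    (neg_le_abs _).trans ((abs_real_inner_le_norm y _).trans
      (mul_le_mul_of_nonneg_right (hP.bounded_domH y hy) (norm_nonneg _)))
  simp only [f] at h1 ⊢
  linarith

/-- A subgradient of `h` at `y` inverts to the gradient of the conjugate. -/
lemma gradient_conjH_eq {x : Vec d} (hx : x ∈ P.X) {y w : Vec m} (hy : y ∈ P.domH)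
    (hw : ∀ z ∈ P.domH, P.h y + inner ℝ w (z - y) ≤ P.h z) : gradient P.conjH w = y := by
  have hval : P.conjH w = inner ℝ y w - P.h y := by
    refine le_antisymm (csSup_le ⟨_, Set.mem_image_of_mem _ hy⟩ ?_)
      (le_csSup (hP.bddAbove_conjH hx w) (Set.mem_image_of_mem _ hy))
    rintro _ ⟨z, hz, rfl⟩
    have := hw z hz
    rw [inner_sub_right, real_inner_comm, real_inner_comm y w] at this
    simp only
    linarith
  have hge : ∀ s, inner ℝ y s - P.h y ≤ P.conjH s := fun s =>
    le_csSup (hP.bddAbove_conjH hx s) (Set.mem_image_of_mem _ hy)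
  -- By the Fenchel equality `hval`, the function `h* - ⟪y, ·⟫` has its global minimum `-h y` at
  -- `w`, so its derivative vanishes there.
  have hmin : IsLocalMin (fun s => P.conjH s - InnerProductSpace.toDual ℝ (Vec m) y s) w := by
    refine Eventually.of_forall fun s => ?_
    simp only [InnerProductSpace.toDual_apply_apply]
    linarith [hge s]
  have hd := ((hP.differentiable_conjH w).hasFDerivAt.sub
    (InnerProductSpace.toDual ℝ (Vec m) y).hasFDerivAt)
  have h0 := hmin.hasFDerivAt_eq_zero hd
  rw [gradient, sub_eq_zero.1 h0]
  exact (InnerProductSpace.toDual ℝ (Vec m)).symm_apply_apply y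

lemma hasFDerivWithinAt_F {x : Vec d} (hx : x ∈ P.X) :
    HasFDerivWithinAt P.F (InnerProductSpace.toDual ℝ (Vec d) (P.gradF x)) P.X x := by
  have h1 := (hP.hasGradient_g x hx).hasFDerivWithinAt
  have h2 := (hP.differentiable_conjH (P.l x)).hasGradientAt.hasFDerivAt.comp_hasFDerivWithinAt x
    (hP.hasFDeriv_l x hx)
  have h3 := h1.sub h2
  have hF : P.F = P.g - P.conjH ∘ P.l := by
    funext z
    simp [F_eq]
  have hD : InnerProductSpace.toDual ℝ (Vec d) (P.gradF x)
      = InnerProductSpace.toDual ℝ (Vec d) (P.gradG x)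
        - (InnerProductSpace.toDual ℝ (Vec m) (gradient P.conjH (P.l x))) ∘L P.jacL x := by
    refine ContinuousLinearMap.ext fun z => ?_
    simp [gradF, gradX, ContinuousLinearMap.adjoint_inner_left]
  rw [hF, hD]
  exact h3

lemma continuousOn_gradF (hv : 0 < v) : ContinuousOn P.gradF P.X := by
  have hlip {E : Type} [NormedAddCommGroup E] {k : Vec d → E} {K : ℝ}
      (H : ∀ x ∈ P.X, ∀ x' ∈ P.X, ‖k x - k x'‖ ≤ K * ‖x - x'‖) : ContinuousOn k P.X := by
    refine (LipschitzOnWith.of_dist_le_mul (K := K.toNNReal) fun x hx x' hx' => ?_).continuousOn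
    rw [dist_eq_norm, dist_eq_norm]
    exact (H x hx x' hx').trans
      (mul_le_mul_of_nonneg_right (Real.le_coe_toNNReal K) (norm_nonneg _))
  have hl : ContinuousOn P.l P.X := fun x hx => (hP.hasFDeriv_l x hx).continuousWithinAt
  have hc : Continuous (gradient P.conjH) := by
    refine continuous_iff_continuousAt.2 fun s => ?_
    rw [ContinuousAt, tendsto_iff_norm_sub_tendsto_zero]
    have ht : Tendsto (fun s' : Vec m => Lh * ‖s' - s‖ ^ v) (𝓝 s) (𝓝 (Lh * ‖s - s‖ ^ v)) := by
      refine Continuous.tendsto ?_ s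
      exact continuous_const.mul
        ((continuous_id.sub continuous_const).norm.rpow_const fun _ => Or.inr hv.le)
    rw [sub_self, norm_zero, Real.zero_rpow hv.ne', mul_zero] at ht
    exact squeeze_zero (fun _ => norm_nonneg _) (fun s' => hP.holder_conjH s' s) ht
  have hJ : ContinuousOn (fun x => ContinuousLinearMap.adjoint (P.jacL x)) P.X :=
    (ContinuousLinearMap.adjoint (𝕜 := ℝ) (E := Vec d) (F := Vec m)).continuous.comp_continuousOn
      (hlip hP.smooth_l)
  exact (hlip hP.smooth_g).sub (hJ.clm_apply (hc.comp_continuousOn hl))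

/-- Differentiability of `F` within `X` reduces the Fréchet condition to a local inequality for `u -
gradF x`. Convexity of `X` makes it global: it holds at `x + s • (z - x)` for small `s`, and `s`
cancels. -/
lemma mem_frechetSubdiff_iff {x u : Vec d} :
    u ∈ frechetSubdiff P.F P.X x ↔ x ∈ P.X ∧ ∀ z ∈ P.X, inner ℝ (u - P.gradF x) (z - x) ≤ 0 := by
  refine ⟨fun ⟨hx, hu⟩ => ⟨hx, fun z hz => ?_⟩, fun ⟨hx, hu⟩ => ⟨hx, fun ε hε => ?_⟩⟩
  · refine le_of_forall_pos_le_add fun δ hδ => ?_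
    -- Both the subgradient inequality and the expansion of `F` lose `ε * ‖z - x‖`, so each must be
    -- at most `δ / 2`; the `+ 1` covers `z = x`.
    set ε : ℝ := δ / (2 * (‖z - x‖ + 1)) with hεdef
    have hn := norm_nonneg (z - x)
    have hε : 0 < ε := by positivity
    have h1 := hu ε hε
    have h2 := ((hasFDerivWithinAt_iff_isLittleO.1 (hP.hasFDerivWithinAt_F hx)).bound hε)
    have hpath : Tendsto (fun s : ℝ => x + s • (z - x)) (𝓝[>] 0) (𝓝[P.X] x) := by
      refine tendsto_nhdsWithin_iff.2 ⟨?_, ?_⟩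
      · have : Tendsto (fun s : ℝ => x + s • (z - x)) (𝓝 0) (𝓝 (x + (0 : ℝ) • (z - x))) :=
          Continuous.tendsto (by fun_prop) 0
        simp only [zero_smul, add_zero] at this
        exact this.mono_left nhdsWithin_le_nhds
      · filter_upwards [Ioc_mem_nhdsGT (zero_lt_one (α := ℝ))] with s hs
        exact hP.convex_X.add_smul_sub_mem hx hz ⟨hs.1.le, hs.2⟩
    obtain ⟨s, ⟨hs1, hs2⟩, hs0⟩ :=
      ((hpath.eventually (h1.and h2)).and (self_mem_nhdsWithin (s := Set.Ioi (0 : ℝ)))).exists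
    have hs0' : 0 < s := hs0
    rw [add_sub_cancel_left] at hs1 hs2
    rw [InnerProductSpace.toDual_apply_apply, Real.norm_eq_abs] at hs2
    have hs3 := (abs_le.1 hs2).2
    rw [norm_smul, Real.norm_eq_abs, abs_of_pos hs0', real_inner_smul_right] at *
    rw [inner_sub_left]
    have h4 : ε * ‖z - x‖ ≤ δ / 2 := by
      rw [hεdef, div_mul_eq_mul_div, div_le_div_iff₀ (by positivity) two_pos]
      nlinarith
    have h5 : s * (inner ℝ u (z - x) - inner ℝ (P.gradF x) (z - x) - δ) ≤ 0 := by nlinarith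
    have := nonpos_of_mul_nonpos_right h5 hs0'
    linarith
  · have h2 := ((hasFDerivWithinAt_iff_isLittleO.1 (hP.hasFDerivWithinAt_F hx)).bound hε)
    filter_upwards [h2, self_mem_nhdsWithin] with z hz hzX
    rw [InnerProductSpace.toDual_apply_apply, Real.norm_eq_abs] at hz
    have h3 := (abs_le.1 hz).1
    have h4 := hu z hzX
    rw [inner_sub_left] at h4
    linarith

/-- The variational inequality survives limits because `gradF` is continuous on `X`; conversely,
constant sequences suffice. -/
lemma mem_limitingSubdiff_iff (hv : 0 < v) {x u : Vec d} :
    u ∈ limitingSubdiff P.F P.X x ↔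
      x ∈ P.X ∧ ∀ z ∈ P.X, inner ℝ (u - P.gradF x) (z - x) ≤ 0 := by
  refine ⟨fun ⟨hx, z, w, hw, hz, _, hwu⟩ => ⟨hx, fun p hp => ?_⟩, fun h => ⟨h.1, fun _ => x,
    fun _ => u, fun _ => hP.mem_frechetSubdiff_iff.2 h, tendsto_const_nhds, tendsto_const_nhds,
    tendsto_const_nhds⟩⟩
  have hz' : Tendsto z atTop (𝓝[P.X] x) :=
    tendsto_nhdsWithin_iff.2 ⟨hz, Eventually.of_forall fun k => (hw k).1⟩
  have hg := (hP.continuousOn_gradF hv x hx).tendsto.comp hz'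
  exact le_of_tendsto ((hwu.sub hg).inner (tendsto_const_nhds.sub hz))
    (Eventually.of_forall fun k => (hP.mem_frechetSubdiff_iff.1 (hw k)).2 p hp)

/-- The distance is lower semicontinuous: near-minimal subgradients along a convergent sequence of
points are bounded, and a limit of a subsequence is a subgradient at the limit point. -/
lemma measurable_stationarity (hv : 0 < v) : Measurable (stationarity P) := by
  refine LowerSemicontinuous.measurable ?_
  rw [lowerSemicontinuous_iff_isClosed_preimage]
  intro r
  rcases eq_or_ne r ⊤ with rfl | hr
  · simp
  refine IsSeqClosed.isClosed fun z x hz hzx => ?_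
  have hr' : ∀ k : ℕ, ∃ u ∈ limitingSubdiff P.F P.X (z k), edist 0 u < r + (k + 1 : ENNReal)⁻¹ := by
    intro k
    refine Metric.infEDist_lt_iff.1 (lt_of_le_of_lt (hz k) (ENNReal.lt_add_right hr ?_))
    simp
  choose u hu hur using hr'
  have hub : ∀ k, u k ∈ Metric.closedBall (0 : Vec d) (r.toReal + 1) := by
    intro k
    have h1 : edist 0 (u k) ≤ r + 1 := (hur k).le.trans (by
      gcongr
      exact ENNReal.inv_le_one.2 (by simp))
    rw [Metric.mem_closedBall, dist_comm, dist_edist]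
    refine (ENNReal.toReal_mono (by finiteness) h1).trans_eq ?_
    rw [ENNReal.toReal_add hr ENNReal.one_ne_top, ENNReal.toReal_one]
  obtain ⟨w, -, φ, hφ, hw⟩ := (isCompact_closedBall (0 : Vec d) (r.toReal + 1)).tendsto_subseq hub
  have hX : ∀ k, z k ∈ P.X := fun k => ((hP.mem_limitingSubdiff_iff hv).1 (hu k)).1
  have hx : x ∈ P.X := hP.isClosed_X.isSeqClosed hX hzx
  have hzφ : Tendsto (z ∘ φ) atTop (𝓝[P.X] x) :=
    tendsto_nhdsWithin_iff.2 ⟨hzx.comp hφ.tendsto_atTop, Eventually.of_forall fun k => hX _⟩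
  have hmem : w ∈ limitingSubdiff P.F P.X x := by
    refine (hP.mem_limitingSubdiff_iff hv).2 ⟨hx, fun p hp => ?_⟩
    have hg := (hP.continuousOn_gradF hv x hx).tendsto.comp hzφ
    exact le_of_tendsto ((hw.sub hg).inner
      (tendsto_const_nhds.sub (hzφ.mono_right nhdsWithin_le_nhds)))
      (Eventually.of_forall fun k => ((hP.mem_limitingSubdiff_iff hv).1 (hu (φ k))).2 p hp)
  refine (Metric.infEDist_le_edist_of_mem hmem).trans ?_
  have hlim : Tendsto (fun k : ℕ => r + ((k : ENNReal) + 1)⁻¹) atTop (𝓝 (r + 0)) := by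
    refine Tendsto.const_add _ ?_
    have := (ENNReal.tendsto_inv_nat_nhds_zero).comp (tendsto_add_atTop_nat 1)
    refine this.congr fun k => ?_
    simp
  rw [add_zero] at hlim
  exact le_of_tendsto_of_tendsto' (tendsto_const_nhds.edist hw) (hlim.comp hφ.tendsto_atTop)
    fun k => (hur (φ k)).le

end Regular

end Problem

/-! ### Joint smoothness and the analysis of one inexact step -/

lemma jointSmoothness_sq (Lg Gl Ll Dy : ℝ) :
    2 * Lg ^ 2 + 4 * Ll ^ 2 * Dy ^ 2 + Gl ^ 2 ≤ jointSmoothness Lg Gl Ll Dy ^ 2 ∧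
      4 * Gl ^ 2 ≤ jointSmoothness Lg Gl Ll Dy ^ 2 := by
  rw [jointSmoothness, Real.sq_sqrt (le_max_of_le_right (by positivity))]
  exact ⟨le_max_left _ _, le_max_right _ _⟩

/-- The left side is `a * A + b * B`, where `(A, B)` is the image of `(a, b)` under a symmetric
matrix. Cauchy–Schwarz reduces the claim to `A² + B² ≤ L² (a² + b²)`; the two entries of the maximum
in `jointSmoothness` are the coefficients of `a²` and `b²` in a bound for `A² + B²`. -/
lemma quadratic_le_jointSmoothness (Lg Gl Ll Dy a b : ℝ) :
    (Lg + Ll * Dy) * a ^ 2 + 2 * Gl * (a * b)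
      ≤ jointSmoothness Lg Gl Ll Dy * (a ^ 2 + b ^ 2) := by
  obtain ⟨h1, h2⟩ := jointSmoothness_sq Lg Gl Ll Dy
  have hL : 0 ≤ jointSmoothness Lg Gl Ll Dy := Real.sqrt_nonneg _
  set L := jointSmoothness Lg Gl Ll Dy
  refine abs_le_of_sq_le_sq' ?_ (by positivity) |>.2
  set A := (Lg + Ll * Dy) * a + Gl * b
  set B := Gl * a
  have e : (Lg + Ll * Dy) * a ^ 2 + 2 * Gl * (a * b) = a * A + b * B := by
    simp only [A, B]; ring
  have hAB : A ^ 2 + B ^ 2 ≤ L ^ 2 * (a ^ 2 + b ^ 2) := by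
    have h3 : A ^ 2 ≤ 2 * (Lg * a) ^ 2 + 4 * (Ll * Dy * a) ^ 2 + 4 * (Gl * b) ^ 2 := by
      simp only [A]
      nlinarith [sq_nonneg (Lg * a - (Ll * Dy * a + Gl * b)), sq_nonneg (Ll * Dy * a - Gl * b)]
    simp only [B]
    nlinarith [mul_le_mul_of_nonneg_right h1 (sq_nonneg a),
      mul_le_mul_of_nonneg_right h2 (sq_nonneg b)]
  have hCS : (a * A + b * B) ^ 2 ≤ (a ^ 2 + b ^ 2) * (A ^ 2 + B ^ 2) := by
    nlinarith [sq_nonneg (a * B - b * A)]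
  rw [e]
  calc (a * A + b * B) ^ 2 ≤ (a ^ 2 + b ^ 2) * (A ^ 2 + B ^ 2) := hCS
    _ ≤ (a ^ 2 + b ^ 2) * (L ^ 2 * (a ^ 2 + b ^ 2)) := by gcongr
    _ = (L * (a ^ 2 + b ^ 2)) ^ 2 := by ring

namespace Problem.Regular

variable {d m : ℕ} {P : Problem d m} {Lg Gl Ll Dy Lh v M : ℝ}
variable (hP : P.Regular Lg Gl Ll Dy Lh v M)
include hP

lemma norm_l_sub_le {x x' : Vec d} (hx : x ∈ P.X) (hx' : x' ∈ P.X) :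
    ‖P.l x' - P.l x‖ ≤ Gl * ‖x' - x‖ :=
  hP.convex_X.norm_image_sub_le_of_norm_hasFDerivWithin_le hP.hasFDeriv_l hP.lipschitz_l hx hx'

/-- The change is split at `(x', y)`, so that the Jacobian difference acts only on the bounded
vector `y`. -/
lemma norm_gradX_sub_le (hLl : 0 ≤ Ll) {x x' : Vec d} {y y' : Vec m} (hx : x ∈ P.X)
    (hx' : x' ∈ P.X) (hy : y ∈ P.domH) :
    ‖P.gradX x' y' - P.gradX x y‖ ≤ (Lg + Ll * Dy) * ‖x' - x‖ + Gl * ‖y' - y‖ := by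
  have e : P.gradX x' y' - P.gradX x y = (P.gradG x' - P.gradG x)
      - ContinuousLinearMap.adjoint (P.jacL x' - P.jacL x) y
      - ContinuousLinearMap.adjoint (P.jacL x') (y' - y) := by
    simp only [gradX, map_sub, sub_apply]
    abel
  have h1 := hP.smooth_g x' hx' x hx
  have h2 : ‖ContinuousLinearMap.adjoint (P.jacL x' - P.jacL x) y‖ ≤ Ll * ‖x' - x‖ * Dy := by
    refine (ContinuousLinearMap.le_opNorm _ _).trans ?_
    rw [LinearIsometryEquiv.norm_map]
    exact mul_le_mul (hP.smooth_l x' hx' x hx) (hP.bounded_domH y hy) (norm_nonneg _)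
      (by positivity)
  have h3 : ‖ContinuousLinearMap.adjoint (P.jacL x') (y' - y)‖ ≤ Gl * ‖y' - y‖ := by
    refine (ContinuousLinearMap.le_opNorm _ _).trans ?_
    rw [LinearIsometryEquiv.norm_map]
    exact mul_le_mul_of_nonneg_right (hP.lipschitz_l x' hx') (norm_nonneg _)
  rw [e]
  refine (norm_sub_le _ _).trans ?_
  refine (add_le_add (norm_sub_le _ _) le_rfl).trans ?_
  linarith

/-- First-order upper bound for `f₀(x, y) = g(x) - ⟪y, ℓ(x)⟫`. -/
lemma smooth_part_le (hLg : 0 ≤ Lg) (hLl : 0 ≤ Ll) (hDy : 0 ≤ Dy) {x x' : Vec d} {y y' : Vec m}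
    (hx : x ∈ P.X) (hx' : x' ∈ P.X) (hy : y ∈ P.domH) :
    (P.g x' - inner ℝ y' (P.l x')) - (P.g x - inner ℝ y (P.l x))
        - (inner ℝ (P.gradX x y) (x' - x) - inner ℝ (P.l x) (y' - y))
      ≤ jointSmoothness Lg Gl Ll Dy * (‖x' - x‖ ^ 2 + ‖y' - y‖ ^ 2) := by
  set p : ℝ → Vec d := fun s => x + s • (x' - x)
  set q : ℝ → Vec m := fun s => y + s • (y' - y)
  have hp : ∀ s ∈ Set.Icc (0 : ℝ) 1, p s ∈ P.X := fun s hs =>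
    hP.convex_X.add_smul_sub_mem hx hx' hs
  have hpd : ∀ s, HasDerivWithinAt p (x' - x) (Set.Icc 0 1) s := fun s => by
    have := (((hasDerivAt_id s).smul_const (x' - x)).const_add x).hasDerivWithinAt
      (s := Set.Icc (0 : ℝ) 1)
    rwa [one_smul] at this
  have hqd : ∀ s, HasDerivWithinAt q (y' - y) (Set.Icc 0 1) s := fun s => by
    have := (((hasDerivAt_id s).smul_const (y' - y)).const_add y).hasDerivWithinAt
      (s := Set.Icc (0 : ℝ) 1)
    rwa [one_smul] at this
  set S : ℝ := inner ℝ (P.gradX x y) (x' - x) - inner ℝ (P.l x) (y' - y)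
  set φ : ℝ → ℝ := fun s => P.g (p s) - inner ℝ (q s) (P.l (p s)) - s * S
  set φ' : ℝ → ℝ := fun s => inner ℝ (P.gradG (p s)) (x' - x)
    - (inner ℝ (q s) (P.jacL (p s) (x' - x)) + inner ℝ (y' - y) (P.l (p s))) - S
  have hφ : ∀ s ∈ Set.Icc (0 : ℝ) 1, HasDerivWithinAt φ (φ' s) (Set.Icc 0 1) s := by
    intro s hs
    have h1 := (hP.hasGradient_g (p s) (hp s hs)).hasFDerivWithinAt.comp_hasDerivWithinAt s
      (hpd s) hp
    have h2 := (hP.hasFDeriv_l (p s) (hp s hs)).comp_hasDerivWithinAt s (hpd s) hp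
    have h3 := (hqd s).inner ℝ h2
    have h4 := ((hasDerivAt_id s).mul_const S).hasDerivWithinAt (s := Set.Icc (0 : ℝ) 1)
    have h5 := (h1.sub h3).sub h4
    rwa [one_mul, InnerProductSpace.toDual_apply_apply] at h5
  -- The derivative is bounded uniformly in `s` instead of proportionally to `s`. This yields the
  -- constant `L` in place of `L / 2`, which the condition `c < 1 / 2` accommodates.
  have hbound : ∀ s ∈ Set.Ico (0 : ℝ) 1,
      ‖φ' s‖ ≤ jointSmoothness Lg Gl Ll Dy * (‖x' - x‖ ^ 2 + ‖y' - y‖ ^ 2) := by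
    intro s hs
    have hs' : s ∈ Set.Icc (0 : ℝ) 1 := ⟨hs.1, hs.2.le⟩
    have e : φ' s = inner ℝ (P.gradX (p s) (q s) - P.gradX x y) (x' - x)
        - inner ℝ (P.l (p s) - P.l x) (y' - y) := by
      simp only [φ', S, gradX, inner_sub_left, ContinuousLinearMap.adjoint_inner_left]
      rw [← inner_sub_left, real_inner_comm (P.l (p s)) (y' - y)]
      ring
    have hpx : ‖p s - x‖ ≤ ‖x' - x‖ := by
      simp only [p, add_sub_cancel_left, norm_smul, Real.norm_eq_abs, abs_of_nonneg hs.1]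
      exact mul_le_of_le_one_left (norm_nonneg _) hs.2.le
    have hqy : ‖q s - y‖ ≤ ‖y' - y‖ := by
      simp only [q, add_sub_cancel_left, norm_smul, Real.norm_eq_abs, abs_of_nonneg hs.1]
      exact mul_le_of_le_one_left (norm_nonneg _) hs.2.le
    have hGl : 0 ≤ Gl := (norm_nonneg _).trans (hP.lipschitz_l x hx)
    rw [e]
    refine (norm_sub_le _ _).trans ?_
    have h1 : ‖inner ℝ (P.gradX (p s) (q s) - P.gradX x y) (x' - x)‖
        ≤ ((Lg + Ll * Dy) * ‖x' - x‖ + Gl * ‖y' - y‖) * ‖x' - x‖ := by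
      refine (norm_inner_le_norm _ _).trans (mul_le_mul_of_nonneg_right ?_ (norm_nonneg _))
      refine (hP.norm_gradX_sub_le hLl hx (hp s hs') hy).trans ?_
      gcongr
    have h2 : ‖inner ℝ (P.l (p s) - P.l x) (y' - y)‖ ≤ (Gl * ‖x' - x‖) * ‖y' - y‖ := by
      refine (norm_inner_le_norm _ _).trans (mul_le_mul_of_nonneg_right ?_ (norm_nonneg _))
      refine (hP.norm_l_sub_le hx (hp s hs')).trans ?_
      gcongr
    have h3 := quadratic_le_jointSmoothness Lg Gl Ll Dy ‖x' - x‖ ‖y' - y‖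
    linarith
  have hmvt := norm_image_sub_le_of_norm_deriv_le_segment' hφ hbound 1 ⟨zero_le_one, le_rfl⟩
  have := (le_abs_self _).trans hmvt
  simp only [φ, p, q, one_smul, zero_smul, add_sub_cancel, add_zero, zero_mul, one_mul, sub_zero,
    mul_one] at this
  linarith

/-- One proximal gradient step with inexact gradients decreases `f` up to the gradient errors. -/
lemma descent_step (hLg : 0 ≤ Lg) (hLl : 0 ≤ Ll) (hDy : 0 ≤ Dy) {c κ : ℝ} (hc : 0 < c)
    (hκ : 0 < κ) (hL : 0 < jointSmoothness Lg Gl Ll Dy)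
    (hκc : κ = jointSmoothness Lg Gl Ll Dy / (2 * c) - jointSmoothness Lg Gl Ll Dy)
    {x x' gx : Vec d} {y y' gy : Vec m} (hx : x ∈ P.X) (hy : y ∈ P.domH)
    (hsx : IsProjection P.X (x - (c / jointSmoothness Lg Gl Ll Dy) • gx) x')
    (hsy : IsProx P.h P.domH (c / jointSmoothness Lg Gl Ll Dy)
      (y - (c / jointSmoothness Lg Gl Ll Dy) • gy) y') :
    κ / 2 * (‖x' - x‖ ^ 2 + ‖y' - y‖ ^ 2) ≤ P.f x y - P.f x' y'
      + (2 * κ)⁻¹ * (‖gx - P.gradX x y‖ ^ 2 + ‖gy + P.l x‖ ^ 2) := by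
  set L := jointSmoothness Lg Gl Ll Dy with hLdef
  have hη : 0 < c / L := div_pos hc hL
  have h1 := (hsx.isProx hη).step_le hη hx
  have h2 := hsy.step_le hη hy
  have h3 := hP.smooth_part_le hLg hLl hDy hx hsx.1 hy (y' := y')
  rw [← hLdef] at h3
  -- Thus `κ` is what remains of the proximal coefficient after paying `L` for smoothness; Young's
  -- inequality below spends half of it on the gradient errors.
  have hη2 : 1 / (2 * (c / L)) = κ + L := by
    rw [hκc]; field_simp; ring
  rw [hη2] at h1 h2
  have young : ∀ {n : ℕ} (e w : Vec n),
      -inner ℝ e w ≤ κ / 2 * ‖w‖ ^ 2 + (2 * κ)⁻¹ * ‖e‖ ^ 2 := by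
    intro n e w
    have h := (neg_le_abs _).trans (abs_real_inner_le_norm e w)
    have h' : ‖e‖ * ‖w‖ ≤ κ / 2 * ‖w‖ ^ 2 + (2 * κ)⁻¹ * ‖e‖ ^ 2 := by
      have : κ / 2 * ‖w‖ ^ 2 + (2 * κ)⁻¹ * ‖e‖ ^ 2 - ‖e‖ * ‖w‖
          = (2 * κ)⁻¹ * (κ * ‖w‖ - ‖e‖) ^ 2 := by field_simp; ring
      have : 0 ≤ (2 * κ)⁻¹ * (κ * ‖w‖ - ‖e‖) ^ 2 := by positivity
      linarith
    linarith
  have h4 := young (gx - P.gradX x y) (x' - x)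
  have h5 := young (gy + P.l x) (y' - y)
  rw [inner_sub_left] at h4
  rw [inner_add_left] at h5
  simp only [f]
  nlinarith

/-- The projection supplies the normal vector `η⁻¹ • (x - η • gx - x')`, and `∇F(x')` plus this
vector is the subgradient. The proximal step gives `y' = ∇h*(w)`, so `∇F(x')` differs from `∇ₓf₀(x',
y')` by the adjoint Jacobian applied to `∇h*(w) - ∇h*(ℓ(x'))`. This is the source of the exponent
`v`. -/
lemma exists_mem_limitingSubdiff_step (hv : 0 < v) (hLg : 0 ≤ Lg) (hLl : 0 ≤ Ll) (hLh : 0 ≤ Lh)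
    (hDy : 0 ≤ Dy) {η : ℝ} (hη : 0 < η)
    {x x' gx : Vec d} {y y' gy : Vec m} (hx : x ∈ P.X) (hy : y ∈ P.domH)
    (hsx : IsProjection P.X (x - η • gx) x') (hsy : IsProx P.h P.domH η (y - η • gy) y') :
    ∃ u ∈ limitingSubdiff P.F P.X x',
      ‖u‖ ≤ (η⁻¹ + (Lg + Ll * Dy) + Gl + 1)
          * (‖x' - x‖ + ‖y' - y‖ + ‖gx - P.gradX x y‖ + ‖gy + P.l x‖)
        + Gl * Lh * ((η⁻¹ + (Lg + Ll * Dy) + Gl + 1)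
          * (‖x' - x‖ + ‖y' - y‖ + ‖gx - P.gradX x y‖ + ‖gy + P.l x‖)) ^ v := by
  have hGl : 0 ≤ Gl := (norm_nonneg _).trans (hP.lipschitz_l x hx)
  have hη' : 0 < η⁻¹ := inv_pos.2 hη
  have hx' := hsx.1
  have hy' := hsy.1
  set K := η⁻¹ + (Lg + Ll * Dy) + Gl + 1 with hK
  set r := ‖x' - x‖ + ‖y' - y‖ + ‖gx - P.gradX x y‖ + ‖gy + P.l x‖ with hr
  have hLD : 0 ≤ Lg + Ll * Dy := by positivity
  have n1 := norm_nonneg (x' - x)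
  have n2 := norm_nonneg (y' - y)
  have n3 := norm_nonneg (gx - P.gradX x y)
  have n4 := norm_nonneg (gy + P.l x)
  refine ⟨P.gradF x' + η⁻¹ • (x - η • gx - x'), ?_, ?_⟩
  · refine (hP.mem_limitingSubdiff_iff hv).2 ⟨hx', fun z hz => ?_⟩
    rw [add_sub_cancel_left]
    have := (hsx.isProx hη).subgradient (convexOn_const 0 hP.convex_X) hη hz
    simpa using this
  · set w := η⁻¹ • (y - η • gy - y') with hw
    have hgw : gradient P.conjH w = y' :=
      hP.gradient_conjH_eq hx hy' fun z hz => hsy.subgradient hP.convex_h hη hz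
    have e : P.gradF x' + η⁻¹ • (x - η • gx - x')
        = ContinuousLinearMap.adjoint (P.jacL x') (gradient P.conjH w - gradient P.conjH (P.l x'))
          + (P.gradX x' y' - P.gradX x y) - (gx - P.gradX x y) - η⁻¹ • (x' - x) := by
      have h1 : η⁻¹ • (x - η • gx - x') = -(η⁻¹ • (x' - x)) - gx := by
        rw [smul_sub, smul_sub, smul_smul, inv_mul_cancel₀ hη.ne', one_smul, smul_sub]
        abel
      rw [h1, hgw, gradF]
      simp only [gradX, map_sub]
      abel
    -- The vector `w` is `-gy` minus the scaled step, and `-gy` estimates `ℓ(x)`; all coefficients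
    -- are absorbed in `K`.
    have hwn : ‖w - P.l x'‖ ≤ K * r := by
      have h1 : w - P.l x' = -(η⁻¹ • (y' - y)) - (gy + P.l x) - (P.l x' - P.l x) := by
        rw [hw, smul_sub, smul_sub, smul_smul, inv_mul_cancel₀ hη.ne', one_smul, smul_sub]
        abel
      have h2 : ‖w - P.l x'‖ ≤ η⁻¹ * ‖y' - y‖ + ‖gy + P.l x‖ + Gl * ‖x' - x‖ := by
        rw [h1]
        refine (norm_sub_le _ _).trans (add_le_add ((norm_sub_le _ _).trans ?_)
          (hP.norm_l_sub_le hx hx'))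
        rw [norm_neg, norm_smul, Real.norm_eq_abs, abs_of_pos hη']
      refine h2.trans ?_
      calc η⁻¹ * ‖y' - y‖ + ‖gy + P.l x‖ + Gl * ‖x' - x‖ ≤ K * ‖y' - y‖ + K * ‖gy + P.l x‖
            + K * ‖x' - x‖ := by
            gcongr
            · linarith
            · exact le_mul_of_one_le_left n4 (by linarith)
            · linarith
        _ ≤ K * r := by
            rw [← mul_add, ← mul_add]
            refine mul_le_mul_of_nonneg_left ?_ (by positivity)
            rw [hr]; linarith
    have h1 : ‖ContinuousLinearMap.adjoint (P.jacL x')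
        (gradient P.conjH w - gradient P.conjH (P.l x'))‖ ≤ Gl * Lh * (K * r) ^ v := by
      refine (ContinuousLinearMap.le_opNorm _ _).trans ?_
      rw [LinearIsometryEquiv.norm_map, mul_assoc]
      refine mul_le_mul (hP.lipschitz_l x' hx') ?_ (norm_nonneg _) hGl
      refine (hP.holder_conjH _ _).trans ?_
      gcongr
    have h2 := hP.norm_gradX_sub_le hLl hx hx' hy (y' := y')
    rw [e]
    calc _ ≤ Gl * Lh * (K * r) ^ v + ((Lg + Ll * Dy) * ‖x' - x‖ + Gl * ‖y' - y‖)
          + ‖gx - P.gradX x y‖ + η⁻¹ * ‖x' - x‖ := by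
          refine (norm_sub_le _ _).trans (add_le_add ((norm_sub_le _ _).trans
            (add_le_add ((norm_add_le _ _).trans (add_le_add h1 h2)) le_rfl)) ?_)
          rw [norm_smul, Real.norm_eq_abs, abs_of_pos hη']
      _ ≤ K * r + Gl * Lh * (K * r) ^ v := by
          have : (Lg + Ll * Dy) * ‖x' - x‖ + Gl * ‖y' - y‖ + ‖gx - P.gradX x y‖
              + η⁻¹ * ‖x' - x‖ ≤ K * r := by
            rw [hK, hr]
            have hp : 0 ≤ η⁻¹ * ‖y' - y‖ := by positivity
            nlinarith [mul_nonneg hLD n2, mul_nonneg hLD n3, mul_nonneg hLD n4,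
              mul_nonneg hGl n1, mul_nonneg hGl n3, mul_nonneg hGl n4,
              mul_nonneg hη'.le n3, mul_nonneg hη'.le n4]
          linarith

end Problem.Regular

/-! ### Weighted summation along a deterministic run -/

/-- Abel summation as an induction: since `K - f (n + 1) ≥ 0`, its weight may be raised from `w n`
to `w (n + 1)` before the next difference is added. -/
lemma sum_weight_mul_sub_le {w f : ℕ → ℝ} {K : ℝ} (hw : Monotone w) (hw0 : 0 ≤ w 0) (n : ℕ)
    (hf : ∀ s ∈ Finset.Icc 1 (n + 1), f s ≤ K) :
    ∑ s ∈ Finset.Icc 1 n, w s * (f s - f (s + 1)) ≤ w n * (K - f (n + 1)) := by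
  induction n with
  | zero => simpa using mul_nonneg hw0 (sub_nonneg.2 (hf 1 (by simp)))
  | succ n ih =>
    rw [Finset.sum_Icc_succ_top (by omega)]
    have h1 := ih fun s hs => hf s (Finset.Icc_subset_Icc_right (by omega) hs)
    have h2 : f (n + 1) ≤ K := hf _ (by simp)
    have h3 := mul_le_mul_of_nonneg_right (hw (Nat.le_succ n)) (sub_nonneg.2 h2)
    have : w (n + 1) * (K - f (n + 1)) + w (n + 1) * (f (n + 1) - f (n + 1 + 1))
        = w (n + 1) * (K - f (n + 1 + 1)) := by ring
    simp only [Nat.succ_eq_add_one] at h3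
    linarith

/-- One of the two terms alone suffices, according to whether `t * a ≤ 1`. Linearising the Hölder
term at a time-dependent scale lets the descent inequality be summed against weights. -/
lemma rpow_le_add_of_pos {a t v : ℝ} (ha : 0 ≤ a) (ht : 0 < t) (hv : 0 < v) (hv1 : v ≤ 1) :
    a ^ v ≤ t ^ (1 - v) * a + t ^ (-v) := by
  rcases le_or_gt a t⁻¹ with h | h
  · have h1 : a ^ v ≤ t ^ (-v) := by
      rw [Real.rpow_neg ht.le, ← Real.inv_rpow ht.le]
      exact Real.rpow_le_rpow ha h hv.le
    have : 0 ≤ t ^ (1 - v) * a := by positivity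
    linarith
  · have ha' : 0 < a := (inv_pos.2 ht).trans h
    have h1 : 1 ≤ (t * a) ^ (1 - v) :=
      Real.one_le_rpow (by rw [← inv_le_iff_one_le_mul₀' ht]; exact h.le) (by linarith)
    have h2 : a ^ v * a ^ (1 - v) = a := by
      rw [← Real.rpow_add ha', add_sub_cancel, Real.rpow_one]
    rw [Real.mul_rpow ht.le ha] at h1
    have h3 : a ^ v ≤ t ^ (1 - v) * a := by
      calc a ^ v = a ^ v * 1 := (mul_one _).symm
        _ ≤ a ^ v * (t ^ (1 - v) * a ^ (1 - v)) := by gcongr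
        _ = t ^ (1 - v) * a := by rw [← mul_assoc, mul_right_comm, mul_comm, h2]
    have : 0 ≤ t ^ (-v) := by positivity
    linarith

lemma add_four_sq_le (p q r s : ℝ) :
    (p + q + r + s) ^ 2 ≤ 4 * (p ^ 2 + q ^ 2 + r ^ 2 + s ^ 2) := by
  nlinarith [sq_nonneg (p - q), sq_nonneg (p - r), sq_nonneg (p - s), sq_nonneg (q - r),
    sq_nonneg (q - s), sq_nonneg (r - s)]

/-- The joint squared error of a pair of gradient estimates. -/
noncomputable def Problem.gradError {d m : ℕ} (P : Problem d m) (x gx : Vec d) (y gy : Vec m) :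
    ℝ :=
  ‖gx - P.gradX x y‖ ^ 2 + ‖gy + P.l x‖ ^ 2

lemma Problem.gradError_nonneg {d m : ℕ} (P : Problem d m) (x gx : Vec d) (y gy : Vec m) :
    0 ≤ P.gradError x gx y gy := by
  unfold gradError; positivity

/-- `(x', y')` arises from `(x, y)` by a proximal step along the gradient estimates `(gx, gy)`. -/
def Problem.IsStep {d m : ℕ} (P : Problem d m) (η : ℝ) (gx : Vec d) (gy : Vec m)
    (x : Vec d) (y : Vec m) (x' : Vec d) (y' : Vec m) : Prop :=
  IsProjection P.X (x - η • gx) x' ∧ IsProx P.h P.domH η (y - η • gy) y'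

theorem exists_stationarity_step_bound {Lg Gl Ll Dy Lh v η : ℝ} (M : ℝ) (hLg : 0 ≤ Lg)
    (hGl : 0 ≤ Gl) (hLl : 0 ≤ Ll) (hDy : 0 ≤ Dy) (hLh : 0 ≤ Lh) (hv : 0 < v) (hη : 0 < η) :
    ∃ K : ℝ, 0 ≤ K ∧ ∀ (d m : ℕ) (P : Problem d m), P.Regular Lg Gl Ll Dy Lh v M →
      ∀ (gx x x' : Vec d) (gy y y' : Vec m), x ∈ P.X → y ∈ P.domH → P.IsStep η gx gy x y x' y' →
      ∀ a, a = ‖x' - x‖ ^ 2 + ‖y' - y‖ ^ 2 + P.gradError x gx y gy →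
        stationarity P x' ^ 2 ≤ ENNReal.ofReal (K * (a + a ^ v)) := by
  set κ := η⁻¹ + (Lg + Ll * Dy) + Gl + 1
  have hκ : 0 ≤ κ := by positivity
  -- The constant comes from `(p + q)² ≤ 2p² + 2q²` and `r² ≤ 4a`, applied to the linear and the
  -- Hölder term.
  refine ⟨8 * κ ^ 2 + 2 * (Gl * Lh) ^ 2 * (4 * κ ^ 2) ^ v, by positivity,
    fun d m P hP gx x x' gy y y' hx hy hs a ha => ?_⟩
  obtain ⟨u, hu, hun⟩ := hP.exists_mem_limitingSubdiff_step hv hLg hLl hLh hDy hη hx hy hs.1 hs.2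
  set r := ‖x' - x‖ + ‖y' - y‖ + ‖gx - P.gradX x y‖ + ‖gy + P.l x‖ with hr
  have hr0 : 0 ≤ r := by positivity
  have ha0 : 0 ≤ a := by
    rw [ha]; exact add_nonneg (by positivity) (P.gradError_nonneg _ _ _ _)
  have hra : r ^ 2 ≤ 4 * a := by
    have := add_four_sq_le ‖x' - x‖ ‖y' - y‖ ‖gx - P.gradX x y‖ ‖gy + P.l x‖
    rw [ha, hr, Problem.gradError]
    linarith
  have hκr : (κ * r) ^ 2 ≤ 4 * κ ^ 2 * a := by
    rw [mul_pow]
    have := mul_le_mul_of_nonneg_left hra (sq_nonneg κ)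
    linarith
  have hpow : ((κ * r) ^ v) ^ 2 ≤ (4 * κ ^ 2) ^ v * a ^ v := by
    rw [← Real.mul_rpow (by positivity) ha0, ← Real.rpow_natCast, ← Real.rpow_mul (by positivity),
      mul_comm v, Real.rpow_mul (by positivity), Real.rpow_natCast]
    exact Real.rpow_le_rpow (by positivity) hκr hv.le
  have hsq : ‖u‖ ^ 2 ≤ (8 * κ ^ 2 + 2 * (Gl * Lh) ^ 2 * (4 * κ ^ 2) ^ v) * (a + a ^ v) := by
    have h1 : ‖u‖ ^ 2 ≤ (κ * r + Gl * Lh * (κ * r) ^ v) ^ 2 :=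
      pow_le_pow_left₀ (norm_nonneg _) hun 2
    have h2 : (κ * r + Gl * Lh * (κ * r) ^ v) ^ 2
        ≤ 2 * (κ * r) ^ 2 + 2 * (Gl * Lh) ^ 2 * ((κ * r) ^ v) ^ 2 := by
      have := add_sq_le (a := κ * r) (b := Gl * Lh * (κ * r) ^ v)
      rw [mul_pow (Gl * Lh)] at this
      linarith
    have h3 : 2 * (Gl * Lh) ^ 2 * ((κ * r) ^ v) ^ 2
        ≤ 2 * (Gl * Lh) ^ 2 * ((4 * κ ^ 2) ^ v * a ^ v) := by gcongr
    have h4 : 0 ≤ 8 * κ ^ 2 * a ^ v := by positivity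
    have h5 : 0 ≤ 2 * (Gl * Lh) ^ 2 * (4 * κ ^ 2) ^ v * a := by positivity
    rw [add_mul, mul_add, mul_add]
    linarith
  calc stationarity P x' ^ 2 ≤ (ENNReal.ofReal ‖u‖) ^ 2 := by
        gcongr
        refine (Metric.infEDist_le_edist_of_mem hu).trans_eq ?_
        rw [edist_comm, edist_dist, dist_zero_right]
    _ = ENNReal.ofReal (‖u‖ ^ 2) := (ENNReal.ofReal_pow (norm_nonneg _) 2).symm
    _ ≤ _ := ENNReal.ofReal_le_ofReal hsq

/-- Weighted sum of the squared stationarity measures along a run of inexact proximal steps. -/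
theorem exists_sum_stationarity_bound {Lg Gl Ll Dy Lh v c α : ℝ} (M : ℝ) (hLg : 0 ≤ Lg)
    (hGl : 0 ≤ Gl) (hLl : 0 ≤ Ll) (hDy : 0 ≤ Dy) (hLh : 0 ≤ Lh)
    (hL : 0 < jointSmoothness Lg Gl Ll Dy) (hv : 0 < v) (hv1 : v ≤ 1)
    (hc : 0 < c) (hc2 : c < 1 / 2) (hα : 0 ≤ α) :
    ∃ K : ℝ, 0 ≤ K ∧ ∀ (d m : ℕ) (P : Problem d m), P.Regular Lg Gl Ll Dy Lh v M →
      ∀ (n : ℕ) (x gx : ℕ → Vec d) (y gy : ℕ → Vec m), x 1 ∈ P.X → y 1 ∈ P.domH →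
      (∀ s ∈ Finset.Icc 1 n, P.IsStep (c / jointSmoothness Lg Gl Ll Dy) (gx s) (gy s)
        (x s) (y s) (x (s + 1)) (y (s + 1))) →
      ∑ s ∈ Finset.Icc 1 n, ENNReal.ofReal ((s + 1 : ℝ) ^ α) * stationarity P (x (s + 1)) ^ 2 ≤
        ENNReal.ofReal (K * ((n + 1 : ℝ) ^ (α + 1 - v)
          + ∑ s ∈ Finset.Icc 1 n, (s + 1 : ℝ) ^ (α + 1 - v - 1)
          + ∑ s ∈ Finset.Icc 1 n, (s + 1 : ℝ) ^ (α + 1 - v)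
              * P.gradError (x s) (gx s) (y s) (gy s))) := by
  set L := jointSmoothness Lg Gl Ll Dy with hLdef
  set β := α + 1 - v with hβ
  have hβ0 : 0 ≤ β := by linarith
  set κ := L / (2 * c) - L with hκdef
  have hκ : 0 < κ := by
    have : L < L / (2 * c) := by
      rw [lt_div_iff₀ (by positivity)]; nlinarith
    linarith
  obtain ⟨K₁, hK₁, H₁⟩ := exists_stationarity_step_bound (η := c / L) M hLg hGl hLl hDy hLh hv
    (div_pos hc hL)
  -- The first summand pays for the telescoped decrease of `f`; the second collects the error from
  -- the descent inequality and the error contained in `a`.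
  set E : ℝ := (κ / 2)⁻¹ * |M| + ((κ / 2)⁻¹ * (2 * κ)⁻¹ + 1) with hE
  have hE0 : 0 ≤ E := by positivity
  refine ⟨K₁ * (2 * E + 1), by positivity, fun d m P hP n x gx y gy hx1 hy1 hstep => ?_⟩
  have hmem : ∀ s ∈ Finset.Icc 1 (n + 1), x s ∈ P.X ∧ y s ∈ P.domH := by
    intro s hs
    obtain ⟨h1, h2⟩ := Finset.mem_Icc.1 hs
    rcases h1.eq_or_lt with rfl | h1
    · exact ⟨hx1, hy1⟩
    · obtain ⟨k, rfl⟩ : ∃ k, s = k + 1 := ⟨s - 1, by omega⟩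
      have := hstep k (Finset.mem_Icc.2 ⟨by omega, by omega⟩)
      exact ⟨this.1.1, this.2.1⟩
  have hmem' : ∀ s ∈ Finset.Icc 1 n, x s ∈ P.X ∧ y s ∈ P.domH := fun s hs =>
    hmem s (Finset.Icc_subset_Icc_right (by omega) hs)
  set e : ℕ → ℝ := fun s => P.gradError (x s) (gx s) (y s) (gy s)
  have he : ∀ s, 0 ≤ e s := fun s => P.gradError_nonneg _ _ _ _
  set a : ℕ → ℝ := fun s => ‖x (s + 1) - x s‖ ^ 2 + ‖y (s + 1) - y s‖ ^ 2 + e s with hadef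
  have ha : ∀ s, 0 ≤ a s := fun s => add_nonneg (by positivity) (he s)
  set w : ℕ → ℝ := fun s => (s + 1 : ℝ) ^ β
  have hw : Monotone w := fun s t hst => by
    have : (s : ℝ) ≤ t := by exact_mod_cast hst
    exact Real.rpow_le_rpow (by positivity) (by linarith) hβ0
  have hw0 : ∀ s, 0 ≤ w s := fun s => by positivity
  have hterm : ∀ s ∈ Finset.Icc 1 n,
      ENNReal.ofReal ((s + 1 : ℝ) ^ α) * stationarity P (x (s + 1)) ^ 2
        ≤ ENNReal.ofReal (K₁ * (2 * (w s * a s) + (s + 1 : ℝ) ^ (β - 1))) := by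
    intro s hs
    have h1 := H₁ d m P hP _ _ _ _ _ _ (hmem' s hs).1 (hmem' s hs).2 (hstep s hs) (a s) rfl
    refine (mul_le_mul_right h1 _).trans ?_
    rw [← ENNReal.ofReal_mul (by positivity)]
    refine ENNReal.ofReal_le_ofReal ?_
    have ht : (0 : ℝ) < s + 1 := by positivity
    have ht1 : (1 : ℝ) ≤ s + 1 := by simp
    -- At scale `t = s + 1` the weight `(s + 1) ^ α` becomes `(s + 1) ^ β` on `a s`, with remainder
    -- `(s + 1) ^ (β - 1)`.
    have h2 := rpow_le_add_of_pos (ha s) ht hv hv1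
    have e1 : (s + 1 : ℝ) ^ α * (s + 1 : ℝ) ^ (1 - v) = w s := by
      rw [← Real.rpow_add ht]; simp only [w, hβ]; congr 1; ring
    have e2 : (s + 1 : ℝ) ^ α * (s + 1 : ℝ) ^ (-v) = (s + 1 : ℝ) ^ (β - 1) := by
      rw [← Real.rpow_add ht]; simp only [hβ]; congr 1; ring
    have h3 : (s + 1 : ℝ) ^ α ≤ w s := Real.rpow_le_rpow_of_exponent_le ht1 (by linarith)
    calc (s + 1 : ℝ) ^ α * (K₁ * (a s + a s ^ v))
        ≤ (s + 1 : ℝ) ^ α * (K₁ * (a s + ((s + 1 : ℝ) ^ (1 - v) * a s + (s + 1 : ℝ) ^ (-v)))) := by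
          gcongr
      _ = K₁ * ((s + 1 : ℝ) ^ α * a s + w s * a s + (s + 1 : ℝ) ^ (β - 1)) := by
          rw [← e1, ← e2]; ring
      _ ≤ K₁ * (w s * a s + w s * a s + (s + 1 : ℝ) ^ (β - 1)) := by
          have := ha s
          gcongr
      _ = _ := by ring
  refine (Finset.sum_le_sum hterm).trans ?_
  rw [← ENNReal.ofReal_sum_of_nonneg fun s _ => by
    have := ha s
    have := hw0 s
    positivity]
  refine ENNReal.ofReal_le_ofReal ?_
  rw [← Finset.mul_sum, Finset.sum_add_distrib, ← Finset.mul_sum, mul_assoc]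
  refine mul_le_mul_of_nonneg_left ?_ hK₁
  have hlast := hmem (n + 1) (by simp)
  have hdesc : ∀ s ∈ Finset.Icc 1 n, w s * a s ≤ (κ / 2)⁻¹ *
      (w s * (P.f (x s) (y s) - P.f (x (s + 1)) (y (s + 1))))
      + ((κ / 2)⁻¹ * (2 * κ)⁻¹ + 1) * (w s * e s) := by
    intro s hs
    have h1 := hP.descent_step hLg hLl hDy hc hκ hL hκdef (hmem' s hs).1 (hmem' s hs).2
      (hstep s hs).1 (hstep s hs).2
    have h2 : ‖x (s + 1) - x s‖ ^ 2 + ‖y (s + 1) - y s‖ ^ 2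
        ≤ (κ / 2)⁻¹ * (P.f (x s) (y s) - P.f (x (s + 1)) (y (s + 1)) + (2 * κ)⁻¹ * e s) := by
      rw [← div_eq_inv_mul, le_div_iff₀ (by positivity), mul_comm]
      exact h1
    calc w s * a s ≤ w s * ((κ / 2)⁻¹ * (P.f (x s) (y s) - P.f (x (s + 1)) (y (s + 1))
          + (2 * κ)⁻¹ * e s) + e s) := by
          have := hw0 s
          simp only [hadef]
          gcongr
      _ = _ := by ring
  have hsum := Finset.sum_le_sum hdesc
  rw [Finset.sum_add_distrib, ← Finset.mul_sum, ← Finset.mul_sum] at hsum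
  -- The upper bound for `f` is its last value plus `|M|`, so the telescoped sum is at most `w n *
  -- |M|`.
  have habel := sum_weight_mul_sub_le (f := fun s => P.f (x s) (y s))
    (K := P.f (x (n + 1)) (y (n + 1)) + |M|) hw (hw0 0) n (fun s hs => by
      have := hP.oscillation_f _ (hmem s hs).1 _ (hmem s hs).2 _ hlast.1 _ hlast.2
      have := le_abs_self M
      linarith)
  rw [add_sub_cancel_left] at habel
  have hwa : ∑ s ∈ Finset.Icc 1 n, w s * a s
      ≤ E * (w n + ∑ s ∈ Finset.Icc 1 n, w s * e s) := by
    have hse : 0 ≤ ∑ s ∈ Finset.Icc 1 n, w s * e s :=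
      Finset.sum_nonneg fun s _ => mul_nonneg (hw0 s) (he s)
    have h1 : (κ / 2)⁻¹ * ∑ s ∈ Finset.Icc 1 n,
        w s * (P.f (x s) (y s) - P.f (x (s + 1)) (y (s + 1))) ≤ (κ / 2)⁻¹ * (w n * |M|) :=
      mul_le_mul_of_nonneg_left habel (by positivity)
    have h2 : 0 ≤ (κ / 2)⁻¹ * |M| * ∑ s ∈ Finset.Icc 1 n, w s * e s := by positivity
    have h3 : 0 ≤ ((κ / 2)⁻¹ * (2 * κ)⁻¹ + 1) * w n := mul_nonneg (by positivity) (hw0 n)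
    rw [hE]
    linarith
  have hr : 0 ≤ ∑ s ∈ Finset.Icc 1 n, (s + 1 : ℝ) ^ (β - 1) :=
    Finset.sum_nonneg fun s _ => by positivity
  have hse : 0 ≤ ∑ s ∈ Finset.Icc 1 n, w s * e s :=
    Finset.sum_nonneg fun s _ => mul_nonneg (hw0 s) (he s)
  have hwn := hw0 n
  calc 2 * ∑ s ∈ Finset.Icc 1 n, w s * a s + ∑ s ∈ Finset.Icc 1 n, (s + 1 : ℝ) ^ (β - 1)
      ≤ 2 * (E * (w n + ∑ s ∈ Finset.Icc 1 n, w s * e s))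
        + ∑ s ∈ Finset.Icc 1 n, (s + 1 : ℝ) ^ (β - 1) := by gcongr
    _ ≤ (2 * E + 1) * (w n + ∑ s ∈ Finset.Icc 1 n, (s + 1 : ℝ) ^ (β - 1)
        + ∑ s ∈ Finset.Icc 1 n, w s * e s) := by
        have := mul_nonneg hE0 hr
        linarith

/-! ### Second moments of mini-batch means -/

section Probability

variable {Ω Ξ : Type*} [MeasurableSpace Ω] [MeasurableSpace Ξ] {μ : Measure Ω}

lemma enorm_sq_eq_ofReal {E : Type*} [SeminormedAddCommGroup E] (a : E) :
    ‖a‖ₑ ^ 2 = ENNReal.ofReal (‖a‖ ^ 2) := by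
  rw [ENNReal.ofReal_pow (norm_nonneg _), ofReal_norm]

/-- The second moment of a mean of `k` pairwise independent centered vectors. -/
lemma lintegral_batchMean_sq_le [IsProbabilityMeasure μ] {n : ℕ} {w : ℕ → Ω → Vec n} {s : ℝ}
    (hs : 0 ≤ s) (hw : ∀ i, Integrable (w i) μ)
    (hind : ∀ i j, i ≠ j → IndepFun (w i) (w j) μ) (hmean : ∀ i, ∫ ω, w i ω ∂μ = 0)
    (hsq : ∀ i, ∫⁻ ω, ‖w i ω‖ₑ ^ 2 ∂μ ≤ ENNReal.ofReal s) {k : ℕ} (hk : 0 < k) :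
    ∫⁻ ω, ‖batchMean k (fun i => w i ω)‖ₑ ^ 2 ∂μ ≤ ENNReal.ofReal (s / k) := by
  have hint : ∀ i, Integrable (fun ω => ‖w i ω‖ ^ 2) μ := fun i => by
    refine ⟨((hw i).1.norm.pow 2), ?_⟩
    rw [hasFiniteIntegral_iff_enorm]
    refine lt_of_le_of_lt (le_trans (lintegral_mono fun ω => ?_) (hsq i)) ENNReal.ofReal_lt_top
    rw [enorm_pow, enorm_norm]
  have hsq' : ∀ i, ∫ ω, ‖w i ω‖ ^ 2 ∂μ ≤ s := fun i => by
    rw [← ENNReal.ofReal_le_ofReal_iff hs, ofReal_integral_eq_lintegral_ofReal (hint i)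
      (Eventually.of_forall fun ω => by positivity)]
    simpa only [enorm_sq_eq_ofReal] using hsq i
  have hinner : ∀ i j, Integrable (fun ω => inner ℝ (w i ω) (w j ω)) μ := fun i j => by
    rcases eq_or_ne i j with rfl | hij
    · simpa only [real_inner_self_eq_norm_sq] using hint i
    · exact (hind i j hij).integrable_bilin (hw i) (hw j) (innerSL ℝ)
  have hval : ∀ i j, ∫ ω, inner ℝ (w i ω) (w j ω) ∂μ ≤ if i = j then s else 0 := fun i j => by
    split_ifs with hij
    · subst hij
      simpa only [real_inner_self_eq_norm_sq] using hsq' i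
    · have := (hind i j hij).integral_bilin (hw i) (hw j) (innerSL ℝ)
      rw [hmean i, map_zero] at this
      exact this.le
  have hexp : ∀ ω, ‖batchMean k (fun i => w i ω)‖ ^ 2 = ((k : ℝ)⁻¹) ^ 2 *
      ∑ i ∈ Finset.range k, ∑ j ∈ Finset.range k, inner ℝ (w i ω) (w j ω) := fun ω => by
    rw [batchMean, norm_smul, mul_pow, Real.norm_eq_abs, sq_abs, ← real_inner_self_eq_norm_sq,
      sum_inner]
    simp only [inner_sum]
  have hint' : Integrable (fun ω => ‖batchMean k (fun i => w i ω)‖ ^ 2) μ := by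
    simp only [hexp]
    exact (integrable_finsetSum _ fun i _ => integrable_finsetSum _ fun j _ =>
      hinner i j).const_mul _
  simp only [enorm_sq_eq_ofReal]
  rw [← ofReal_integral_eq_lintegral_ofReal hint' (Eventually.of_forall fun ω => by positivity)]
  refine ENNReal.ofReal_le_ofReal ?_
  simp only [hexp]
  rw [integral_const_mul, integral_finsetSum _ fun i _ => integrable_finsetSum _ fun j _ =>
      hinner i j]
  have hk' : (0 : ℝ) < k := by exact_mod_cast hk
  calc ((k : ℝ)⁻¹) ^ 2 * ∑ i ∈ Finset.range k, ∫ ω, ∑ j ∈ Finset.range k,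
        inner ℝ (w i ω) (w j ω) ∂μ
      ≤ ((k : ℝ)⁻¹) ^ 2 * ∑ i ∈ Finset.range k, s := by
        refine mul_le_mul_of_nonneg_left (Finset.sum_le_sum fun i hi => ?_) (by positivity)
        rw [integral_finsetSum _ fun j _ => hinner i j]
        refine (Finset.sum_le_sum fun j _ => hval i j).trans ?_
        rw [Finset.sum_ite_eq, if_pos hi]
    _ = s / k := by
        rw [Finset.sum_const, Finset.card_range, nsmul_eq_mul]
        field_simp

lemma batchMean_sub_const {V : Type*} [AddCommGroup V] [Module ℝ V] {k : ℕ} (hk : 0 < k)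
    (a : ℕ → V) (v : V) : batchMean k a - v = batchMean k (fun i => a i - v) := by
  have hk' : (k : ℝ) ≠ 0 := by exact_mod_cast hk.ne'
  rw [batchMean, batchMean, Finset.sum_sub_distrib, smul_sub, Finset.sum_const, Finset.card_range,
    ← Nat.cast_smul_eq_nsmul ℝ, smul_smul, inv_mul_cancel₀ hk', one_smul]

/-- A mini-batch estimate at a random parameter that is independent of the batch. -/
lemma lintegral_batchMean_sub_integral_sq_le [IsProbabilityMeasure μ] {ν : Measure Ξ}
    [IsProbabilityMeasure ν] {Θ : Type*} [MeasurableSpace Θ] {n : ℕ} {H : Θ → Ξ → Vec n}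
    (hH : Measurable (Function.uncurry H)) {θ : Ω → Θ} (hθ : Measurable θ) {ζ : ℕ → Ω → Ξ}
    (hζ : ∀ i, Measurable (ζ i)) (hlaw : ∀ i, Measure.map (ζ i) μ = ν)
    (hζind : ∀ i j, i ≠ j → IndepFun (ζ i) (ζ j) μ)
    (hind : IndepFun θ (fun ω i => ζ i ω) μ) {s : ℝ} (hs : 0 ≤ s)
    (hint : ∀ ω, Integrable (H (θ ω)) ν)
    (hvar : ∀ ω, ∫⁻ z, ‖H (θ ω) z - ∫ z', H (θ ω) z' ∂ν‖ₑ ^ 2 ∂ν ≤ ENNReal.ofReal s)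
    {k : ℕ} (hk : 0 < k) :
    ∫⁻ ω, ‖batchMean k (fun i => H (θ ω) (ζ i ω)) - ∫ z', H (θ ω) z' ∂ν‖ₑ ^ 2 ∂μ
      ≤ ENNReal.ofReal (s / k) := by
  have hmean : Measurable fun t : Θ => ∫ z', H t z' ∂ν :=
    (StronglyMeasurable.integral_prod_right hH.stronglyMeasurable).measurable
  set Ψ : Θ × (ℕ → Ξ) → ℝ≥0∞ := fun p =>
    ‖batchMean k (fun i => H p.1 (p.2 i)) - ∫ z', H p.1 z' ∂ν‖ₑ ^ 2
  have hΨ : Measurable Ψ := by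
    refine Measurable.pow_const (Measurable.enorm (Measurable.sub ?_ (hmean.comp measurable_fst))) 2
    have hsum : Measurable fun p : Θ × (ℕ → Ξ) => ∑ i ∈ Finset.range k, H p.1 (p.2 i) := by
      refine Finset.measurable_fun_sum _ fun i _ => ?_
      exact hH.comp (measurable_fst.prodMk ((measurable_pi_apply i).comp measurable_snd))
    exact hsum.const_smul (k : ℝ)⁻¹
  have hζ' : Measurable fun ω i => ζ i ω := measurable_pi_lambda _ hζ
  -- Independence makes the joint law a product; by Tonelli the parameter can be frozen while the
  -- batch is averaged.
  have hmap := (indepFun_iff_map_prod_eq_prod_map_map hθ.aemeasurable hζ'.aemeasurable).1 hind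
  calc ∫⁻ ω, Ψ (θ ω, fun i => ζ i ω) ∂μ
      = ∫⁻ p, Ψ p ∂(Measure.map (fun ω => (θ ω, fun i => ζ i ω)) μ) :=
        (lintegral_map hΨ (hθ.prodMk hζ')).symm
    _ = ∫⁻ ω, ∫⁻ ω', Ψ (θ ω, fun i => ζ i ω') ∂μ ∂μ := by
        have : SFinite (Measure.map (fun ω i => ζ i ω) μ) := inferInstance
        rw [hmap, lintegral_prod _ hΨ.aemeasurable, lintegral_map hΨ.lintegral_prod_right' hθ]
        refine lintegral_congr fun ω => ?_
        exact lintegral_map (hΨ.comp measurable_prodMk_left) hζ'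
    _ ≤ ∫⁻ _, ENNReal.ofReal (s / k) ∂μ := by
        refine lintegral_mono fun ω => ?_
        have hHω : Measurable (H (θ ω)) := hH.comp measurable_prodMk_left
        set c := ∫ z', H (θ ω) z' ∂ν
        have hw : Measurable fun z => H (θ ω) z - c := hHω.sub_const c
        have hΨω : ∀ ω', Ψ (θ ω, fun i => ζ i ω')
            = ‖batchMean k (fun i => H (θ ω) (ζ i ω') - c)‖ₑ ^ 2 := fun ω' => by
          simp only [Ψ, c, batchMean_sub_const hk]
        simp only [hΨω]
        refine lintegral_batchMean_sq_le hs (w := fun i ω' => H (θ ω) (ζ i ω') - c)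
          (fun i => ?_) (fun i j hij => (hζind i j hij).comp hw hw) (fun i => ?_) (fun i => ?_) hk
        · have : Integrable (H (θ ω)) (Measure.map (ζ i) μ) := by rw [hlaw]; exact hint ω
          exact (this.comp_measurable (hζ i)).sub (integrable_const c)
        · have h1 : ∫ z, (H (θ ω) z - c) ∂(Measure.map (ζ i) μ) = 0 := by
            rw [hlaw, integral_sub (hint ω) (integrable_const c)]
            simp [c]
          rwa [integral_map (hζ i).aemeasurable hw.aestronglyMeasurable] at h1
        · have h1 : ∫⁻ z, ‖H (θ ω) z - c‖ₑ ^ 2 ∂(Measure.map (ζ i) μ) ≤ ENNReal.ofReal s := by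
            rw [hlaw]; exact hvar ω
          rwa [lintegral_map (hw.enorm.pow_const 2) (hζ i)] at h1
    _ = ENNReal.ofReal (s / k) := by simp

end Probability

/-! ### Mean and variance of the stochastic gradients of `f₀` -/

section Oracle

variable {d m : ℕ} {Ξ : Type*} [MeasurableSpace Ξ] {O : Oracle d m Ξ} {P : Problem d m}
  {ν : Measure Ξ} {σ : ℝ}

/-- The map `A ↦ Aᵀ y` as a continuous linear map. -/
noncomputable def adjointApply (y : Vec m) : (Vec d →L[ℝ] Vec m) →L[ℝ] Vec d :=
  LinearMap.mkContinuous
    { toFun := fun A => ContinuousLinearMap.adjoint A y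
      map_add' := fun A B => by simp
      map_smul' := fun r A => by simp } ‖y‖ fun A => by
    refine ((ContinuousLinearMap.adjoint A).le_opNorm y).trans_eq ?_
    rw [LinearIsometryEquiv.norm_map, mul_comm]

namespace Oracle.IsUnbiased

variable (hO : O.IsUnbiased P ν σ)
include hO

lemma measurable_gradX :
    Measurable (Function.uncurry fun (p : Vec d × Vec m) z => O.gradX p.1 p.2 z) := by
  have h1 : Measurable fun q : (Vec d × Vec m) × Ξ => O.gradG q.1.1 q.2 :=
    hO.measurable_gradG.comp ((measurable_fst.comp measurable_fst).prodMk measurable_snd)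
  have h2 : Measurable fun q : (Vec d × Vec m) × Ξ => O.jacL q.1.1 q.2 :=
    hO.measurable_jacL.comp ((measurable_fst.comp measurable_fst).prodMk measurable_snd)
  have h3 : Measurable fun q : (Vec d × Vec m) × Ξ =>
      ContinuousLinearMap.adjoint (O.jacL q.1.1 q.2) :=
    (ContinuousLinearMap.adjoint (𝕜 := ℝ) (E := Vec d) (F := Vec m)).continuous.measurable.comp h2
  have h4 : Measurable fun q : (Vec d × Vec m) × Ξ =>
      ContinuousLinearMap.adjoint (O.jacL q.1.1 q.2) q.1.2 :=
    (ContinuousLinearMap.measurable_apply₂ (𝕜 := ℝ) (E := Vec m) (F := Vec d)).comp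
      (h3.prodMk (measurable_snd.comp measurable_fst))
  exact h1.sub h4

lemma measurable_gradY :
    Measurable (Function.uncurry fun (p : Vec d × Vec m) z => O.gradY p.1 p.2 z) :=
  (hO.measurable_l.comp ((measurable_fst.comp measurable_fst).prodMk measurable_snd)).neg

lemma integrable_gradX {x : Vec d} (hx : x ∈ P.X) (y : Vec m) : Integrable (O.gradX x y) ν :=
  (hO.integrable_gradG x hx).sub ((adjointApply y).integrable_comp (hO.integrable_jacL x hx))

lemma integrable_gradY {x : Vec d} (hx : x ∈ P.X) (y : Vec m) : Integrable (O.gradY x y) ν :=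
  (hO.integrable_l x hx).neg

lemma integral_gradX {x : Vec d} (hx : x ∈ P.X) (y : Vec m) :
    ∫ z, O.gradX x y z ∂ν = P.gradX x y := by
  have h1 := (adjointApply y).integral_comp_comm (hO.integrable_jacL x hx)
  rw [hO.mean_jacL x hx] at h1
  have h2 := integral_sub (hO.integrable_gradG x hx)
    ((adjointApply y).integrable_comp (hO.integrable_jacL x hx))
  rw [h1, hO.mean_gradG x hx] at h2
  exact h2

lemma integral_gradY {x : Vec d} (hx : x ∈ P.X) (y : Vec m) :
    ∫ z, O.gradY x y z ∂ν = -P.l x := by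
  rw [← hO.mean_l x hx, ← integral_neg]
  rfl

/-- The inequality `(p + q)² ≤ 2p² + 2q²` avoids any assumption on the correlation of the estimators
of `∇g` and `∇ℓ`. -/
lemma variance_gradX {x : Vec d} (hx : x ∈ P.X) {y : Vec m} {Dy : ℝ} (hy : ‖y‖ ≤ Dy) :
    ∫⁻ z, ‖O.gradX x y z - P.gradX x y‖ₑ ^ 2 ∂ν
      ≤ ENNReal.ofReal (2 * σ ^ 2 + 2 * Dy ^ 2 * σ ^ 2) := by
  have hpt : ∀ z, ‖O.gradX x y z - P.gradX x y‖ₑ ^ 2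
      ≤ ENNReal.ofReal 2 * ‖O.gradG x z - P.gradG x‖ₑ ^ 2
        + ENNReal.ofReal (2 * Dy ^ 2) * ‖O.jacL x z - P.jacL x‖ₑ ^ 2 := by
    intro z
    simp only [enorm_sq_eq_ofReal]
    rw [← ENNReal.ofReal_mul (by positivity), ← ENNReal.ofReal_mul (by positivity),
      ← ENNReal.ofReal_add (by positivity) (by positivity)]
    refine ENNReal.ofReal_le_ofReal ?_
    have e : O.gradX x y z - P.gradX x y = (O.gradG x z - P.gradG x)
        - ContinuousLinearMap.adjoint (O.jacL x z - P.jacL x) y := by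
      simp only [Oracle.gradX, Problem.gradX, map_sub, sub_apply]
      abel
    have h1 : ‖ContinuousLinearMap.adjoint (O.jacL x z - P.jacL x) y‖
        ≤ ‖O.jacL x z - P.jacL x‖ * Dy := by
      refine (ContinuousLinearMap.le_opNorm _ _).trans ?_
      rw [LinearIsometryEquiv.norm_map]
      gcongr
    have h2 : ‖O.gradX x y z - P.gradX x y‖
        ≤ ‖O.gradG x z - P.gradG x‖ + ‖O.jacL x z - P.jacL x‖ * Dy := by
      rw [e]
      exact (norm_sub_le _ _).trans (by gcongr)
    refine (pow_le_pow_left₀ (norm_nonneg _) h2 2).trans (add_sq_le.trans_eq ?_)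
    ring
  have hm : Measurable fun z => ‖O.gradG x z - P.gradG x‖ₑ ^ 2 :=
    ((hO.measurable_gradG.comp measurable_prodMk_left).sub_const _).enorm.pow_const 2
  have hm' : Measurable fun z => ‖O.jacL x z - P.jacL x‖ₑ ^ 2 :=
    ((hO.measurable_jacL.comp measurable_prodMk_left).sub_const _).enorm.pow_const 2
  refine (lintegral_mono hpt).trans ?_
  rw [lintegral_add_left (hm.const_mul _), lintegral_const_mul _ hm, lintegral_const_mul _ hm',
    ENNReal.ofReal_add (by positivity) (by positivity),
    ENNReal.ofReal_mul (p := 2) (q := σ ^ 2) (by positivity),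
    ENNReal.ofReal_mul (p := 2 * Dy ^ 2) (by positivity)]
  exact add_le_add (mul_le_mul_right (hO.variance_gradG x hx) _)
    (mul_le_mul_right (hO.variance_jacL x hx) _)

lemma variance_gradY {x : Vec d} (hx : x ∈ P.X) (y : Vec m) :
    ∫⁻ z, ‖O.gradY x y z - -P.l x‖ₑ ^ 2 ∂ν ≤ ENNReal.ofReal (σ ^ 2) := by
  refine le_trans (lintegral_mono fun z => ?_) (hO.variance_l x hx)
  rw [Oracle.gradY, neg_sub_neg, enorm_sub_rev]

end Oracle.IsUnbiased

end Oracle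

/-! ### Filtration of past samples and the random output index -/

section Sampling

variable {Ω Ξ : Type*} [mΞ : MeasurableSpace Ξ] {ξ : ℕ → ℕ → Ω → Ξ}

/-- The information contained in the samples drawn before iteration `t`. -/
@[reducible] def past (ξ : ℕ → ℕ → Ω → Ξ) (t : ℕ) : MeasurableSpace Ω :=
  ⨆ p ∈ {p : ℕ × ℕ | p.1 < t}, MeasurableSpace.comap (ξ p.1 p.2) mΞ

lemma measurable_sample_past {s t : ℕ} (hst : s < t) (i : ℕ) : Measurable[past ξ t] (ξ s i) :=
  (comap_measurable _).mono
    (le_iSup₂_of_le (f := fun (p : ℕ × ℕ) (_ : p ∈ {p : ℕ × ℕ | p.1 < t}) =>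
      MeasurableSpace.comap (ξ p.1 p.2) mΞ) (s, i) hst le_rfl) le_rfl

lemma past_mono : Monotone (past ξ) := fun _ _ hst =>
  iSup₂_le fun p hp => (measurable_sample_past (lt_of_lt_of_le hp hst) p.2).comap_le

/-- Transfers the independence of `τ` from the whole sample family to every quantity determined by
past samples. -/
lemma past_le_comap (t : ℕ) :
    past ξ t ≤ MeasurableSpace.comap (fun ω (p : ℕ × ℕ) => ξ p.1 p.2 ω) MeasurableSpace.pi :=
  iSup₂_le fun p _ => by
    have h := (measurable_pi_apply (X := fun _ : ℕ × ℕ => Ξ) p).comp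
      (comap_measurable (fun ω (p : ℕ × ℕ) => ξ p.1 p.2 ω))
    exact h.comap_le

variable [mΩ : MeasurableSpace Ω] {μ : Measure Ω} {ν : Measure Ξ}

namespace IsSampling

variable (hξ : IsSampling ξ ν μ)
include hξ

lemma past_le (t : ℕ) : past ξ t ≤ mΩ := iSup₂_le fun p _ => (hξ.measurable p.1 p.2).comap_le

/-- Independent σ-algebras may be grouped over the disjoint index sets `p.1 < t` and `p.1 = t`. -/
lemma indepFun_of_measurable_past {Θ : Type*} [mΘ : MeasurableSpace Θ] {t : ℕ} {θ : Ω → Θ}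
    (hθ : Measurable[past ξ t] θ) : IndepFun θ (fun ω i => ξ t i ω) μ := by
  rw [IndepFun_iff_Indep]
  have hdisj : Disjoint {p : ℕ × ℕ | p.1 < t} {p : ℕ × ℕ | p.1 = t} := by
    rw [Set.disjoint_left]
    intro p h1 h2
    simp only [Set.mem_ofPred_eq] at h1 h2
    omega
  have hind := indep_iSup_of_disjoint
    (fun p : ℕ × ℕ => (hξ.measurable p.1 p.2).comap_le) hξ.indep.iIndep hdisj
  refine indep_of_indep_of_le_right (indep_of_indep_of_le_left hind hθ.comap_le) ?_
  refine Measurable.comap_le ?_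
  refine @measurable_pi_lambda _ _ _ (_) _ _ fun i => ?_
  exact (comap_measurable _).mono
    (le_iSup₂_of_le (f := fun (p : ℕ × ℕ) (_ : p ∈ {p : ℕ × ℕ | p.1 = t}) =>
      MeasurableSpace.comap (ξ p.1 p.2) mΞ) (t, i) rfl le_rfl) le_rfl

end IsSampling

lemma measurable_batchMean {Θ : Type*} [MeasurableSpace Θ] {n : ℕ} {H : Θ → Ξ → Vec n}
    (hH : Measurable (Function.uncurry H)) {θ : Ω → Θ} (hθ : Measurable θ) {ζ : ℕ → Ω → Ξ}
    (hζ : ∀ i, Measurable (ζ i)) (k : ℕ) :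
    Measurable fun ω => batchMean k (fun i => H (θ ω) (ζ i ω)) := by
  have hsum : Measurable fun ω => ∑ i ∈ Finset.range k, H (θ ω) (ζ i ω) := by
    refine Finset.measurable_fun_sum _ fun i _ => ?_
    exact hH.comp (hθ.prodMk (hζ i))
  exact hsum.const_smul (k : ℝ)⁻¹

/-- The expectation at a random index that is independent of the samples. -/
lemma IsOutputIndex.lintegral_eq {τ : Ω → ℕ} {α : ℝ} {T : ℕ} (hτ : IsOutputIndex τ α T ξ μ)
    (hξ : IsSampling ξ ν μ) {φ : ℕ → Ω → ℝ≥0∞}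
    (hφ : ∀ t ∈ Finset.Icc 1 T, Measurable[past ξ t] (φ t)) :
    Measurable (fun ω => φ (τ ω) ω) ∧ ∫⁻ ω, φ (τ ω) ω ∂μ = ∑ t ∈ Finset.Icc 1 T,
      ENNReal.ofReal ((t : ℝ) ^ α / ∑ s ∈ Finset.Icc 1 T, (s : ℝ) ^ α) * ∫⁻ ω, φ t ω ∂μ := by
  classical
  have hset : ∀ t, MeasurableSet {ω | τ ω = t} := fun t => hτ.measurable (measurableSet_singleton t)
  have hφ' : ∀ t ∈ Finset.Icc 1 T, Measurable (φ t) := fun t ht =>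
    (hφ t ht).mono (hξ.past_le t) le_rfl
  have hdec : ∀ ω, φ (τ ω) ω
      = ∑ t ∈ Finset.Icc 1 T, {ω | τ ω = t}.indicator (fun _ => (1 : ℝ≥0∞)) ω * φ t ω := fun ω => by
    rw [Finset.sum_eq_single_of_mem (τ ω) (hτ.mem ω) fun t _ ht => by
      rw [Set.indicator_of_notMem (s := {ω | τ ω = t}) (fun h => ht (Eq.symm h)), zero_mul]]
    rw [Set.indicator_of_mem (by rfl), one_mul]
  have hterm : ∀ t ∈ Finset.Icc 1 T,
      Measurable fun ω => {ω | τ ω = t}.indicator (fun _ => (1 : ℝ≥0∞)) ω * φ t ω :=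
    fun t ht => (measurable_const.indicator (hset t)).mul (hφ' t ht)
  simp only [hdec]
  refine ⟨Finset.measurable_fun_sum _ hterm, ?_⟩
  rw [lintegral_finsetSum _ hterm]
  refine Finset.sum_congr rfl fun t ht => ?_
  have hjoint : Measurable fun ω (p : ℕ × ℕ) => ξ p.1 p.2 ω :=
    measurable_pi_lambda _ fun p => hξ.measurable p.1 p.2
  rw [lintegral_mul_eq_lintegral_mul_lintegral_of_independent_measurableSpace
    hτ.measurable.comap_le hjoint.comap_le ((IndepFun_iff_Indep _ _ _).1 hτ.indep)
    (f := {ω | τ ω = t}.indicator fun _ => 1)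
    (measurable_const.indicator ⟨{t}, measurableSet_singleton t, rfl⟩)
    ((hφ t ht).mono (past_le_comap t) le_rfl)]
  rw [lintegral_indicator_const (hset t), one_mul, hτ.law t ht]

end Sampling

/-! ### Adaptedness and expected errors of MSPG -/

namespace IsMSPGRun

variable {d m : ℕ} {Ω Ξ : Type*} {ξ : ℕ → ℕ → Ω → Ξ} {P : Problem d m} {O : Oracle d m Ξ} {η : ℝ}
  {batch : ℕ → ℕ} {T : ℕ} {x₁ : Vec d} {y₁ : Vec m} {x : ℕ → Ω → Vec d} {y : ℕ → Ω → Vec m}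

lemma isStep (hR : IsMSPGRun P O η batch T ξ x₁ y₁ x y) {t : ℕ} (ht : t ∈ Finset.Icc 1 T) (ω : Ω) :
    P.IsStep η (batchMean (batch t) (fun i => O.gradX (x t ω) (y t ω) (ξ t i ω)))
      (batchMean (batch t) (fun i => O.gradY (x t ω) (y t ω) (ξ t i ω)))
      (x t ω) (y t ω) (x (t + 1) ω) (y (t + 1) ω) :=
  ⟨hR.step_x t ht ω, hR.step_y t ht ω⟩

lemma mem (hR : IsMSPGRun P O η batch T ξ x₁ y₁ x y) (hx₁ : x₁ ∈ P.X) (hy₁ : y₁ ∈ P.domH)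
    {t : ℕ} (ht : t ∈ Finset.Icc 1 T) (ω : Ω) : x t ω ∈ P.X ∧ y t ω ∈ P.domH := by
  obtain ⟨h1, h2⟩ := Finset.mem_Icc.1 ht
  rcases h1.eq_or_lt with rfl | h1
  · rw [hR.init_x, hR.init_y]
    exact ⟨hx₁, hy₁⟩
  · obtain ⟨k, rfl⟩ : ∃ k, t = k + 1 := ⟨t - 1, by omega⟩
    have := hR.isStep (t := k) (Finset.mem_Icc.2 ⟨by omega, by omega⟩) ω
    exact ⟨this.1.1, this.2.1⟩

variable [mΞ : MeasurableSpace Ξ] {ν : Measure Ξ} {σ Lg Gl Ll Dy Lh v M : ℝ}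

/-- The iterates are determined measurably by the past samples. -/
lemma measurable_past (hR : IsMSPGRun P O η batch T ξ x₁ y₁ x y)
    (hP : P.Regular Lg Gl Ll Dy Lh v M) (hO : O.IsUnbiased P ν σ) (hη : 0 < η) {t : ℕ}
    (ht : t ∈ Finset.Icc 1 T) :
    Measurable[past ξ t] (x t) ∧ Measurable[past ξ t] (y t) := by
  obtain ⟨Gx, hGx, hGx'⟩ := exists_continuous_eq_of_isProx (convexOn_const 0 hP.convex_X) hη
  obtain ⟨Gy, hGy, hGy'⟩ := exists_continuous_eq_of_isProx hP.convex_h hη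
  obtain ⟨k, rfl⟩ : ∃ k, t = k + 1 := ⟨t - 1, by have := (Finset.mem_Icc.1 ht).1; omega⟩
  induction k with
  | zero =>
    rw [zero_add, funext hR.init_x, funext hR.init_y]
    exact ⟨measurable_const, measurable_const⟩
  | succ k ih =>
    have hk : k + 1 ∈ Finset.Icc 1 T := by
      have := (Finset.mem_Icc.1 ht).2
      exact Finset.mem_Icc.2 ⟨by omega, by omega⟩
    obtain ⟨hx, hy⟩ := ih hk
    replace hx := hx.mono (past_mono (Nat.le_succ (k + 1))) le_rfl
    replace hy := hy.mono (past_mono (Nat.le_succ (k + 1))) le_rfl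
    have hζ : ∀ i, Measurable[past ξ (k + 1 + 1)] (ξ (k + 1) i) :=
      measurable_sample_past (Nat.lt_succ_self _)
    -- With the past σ-algebra as the structure on `Ω`, the measurability lemma for batch means
    -- yields adaptedness directly.
    let _ : MeasurableSpace Ω := past ξ (k + 1 + 1)
    have hgx := measurable_batchMean hO.measurable_gradX (hx.prodMk hy) hζ (batch (k + 1))
    have hgy := measurable_batchMean hO.measurable_gradY (hx.prodMk hy) hζ (batch (k + 1))
    have ex : x (k + 1 + 1) = fun ω => Gx (x (k + 1) ω - η • batchMean (batch (k + 1))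
        (fun i => O.gradX (x (k + 1) ω) (y (k + 1) ω) (ξ (k + 1) i ω))) :=
      funext fun ω => hGx' _ _ ((hR.isStep hk ω).1.isProx hη)
    have ey : y (k + 1 + 1) = fun ω => Gy (y (k + 1) ω - η • batchMean (batch (k + 1))
        (fun i => O.gradY (x (k + 1) ω) (y (k + 1) ω) (ξ (k + 1) i ω))) :=
      funext fun ω => hGy' _ _ (hR.isStep hk ω).2
    rw [ex, ey]
    exact ⟨hGx.measurable.comp (hx.sub (hgx.const_smul η)),
      hGy.measurable.comp (hy.sub (hgy.const_smul η))⟩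

variable [mΩ : MeasurableSpace Ω] {μ : Measure Ω}

/-- The squared error of the mini-batch gradients is of the order of the reciprocal batch size. -/
lemma lintegral_gradError_le [IsProbabilityMeasure μ] [IsProbabilityMeasure ν]
    (hR : IsMSPGRun P O η batch T ξ x₁ y₁ x y)
    (hP : P.Regular Lg Gl Ll Dy Lh v M) (hO : O.IsUnbiased P ν σ) (hξ : IsSampling ξ ν μ)
    (hη : 0 < η) (hx₁ : x₁ ∈ P.X) (hy₁ : y₁ ∈ P.domH) {t : ℕ} (ht : t ∈ Finset.Icc 1 T)
    (hb : 0 < batch t) :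
    Measurable (fun ω => ENNReal.ofReal (P.gradError (x t ω)
        (batchMean (batch t) (fun i => O.gradX (x t ω) (y t ω) (ξ t i ω))) (y t ω)
        (batchMean (batch t) (fun i => O.gradY (x t ω) (y t ω) (ξ t i ω))))) ∧
    ∫⁻ ω, ENNReal.ofReal (P.gradError (x t ω)
        (batchMean (batch t) (fun i => O.gradX (x t ω) (y t ω) (ξ t i ω))) (y t ω)
        (batchMean (batch t) (fun i => O.gradY (x t ω) (y t ω) (ξ t i ω)))) ∂μ
      ≤ ENNReal.ofReal ((3 * σ ^ 2 + 2 * Dy ^ 2 * σ ^ 2) / batch t) := by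
  have hmem := fun ω => hR.mem hx₁ hy₁ ht ω
  obtain ⟨hx, hy⟩ := hR.measurable_past hP hO hη ht
  have hθ : Measurable[past ξ t] fun ω => (x t ω, y t ω) := hx.prodMk hy
  have hind := hξ.indepFun_of_measurable_past hθ
  have hθ' : Measurable fun ω => (x t ω, y t ω) := hθ.mono (hξ.past_le t) le_rfl
  have hζind : ∀ i j, i ≠ j → IndepFun (ξ t i) (ξ t j) μ := fun i j hij =>
    hξ.indep.indepFun (i := (t, i)) (j := (t, j)) (by simpa using hij)
  have hX := lintegral_batchMean_sub_integral_sq_le hO.measurable_gradX hθ' (hξ.measurable t)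
    (hξ.law t) hζind hind (s := 2 * σ ^ 2 + 2 * Dy ^ 2 * σ ^ 2) (by positivity)
    (fun ω => hO.integrable_gradX (hmem ω).1 _)
    (fun ω => by
      simp only [hO.integral_gradX (hmem ω).1]
      exact hO.variance_gradX (hmem ω).1 (hP.bounded_domH _ (hmem ω).2)) hb
  have hY := lintegral_batchMean_sub_integral_sq_le hO.measurable_gradY hθ' (hξ.measurable t)
    (hξ.law t) hζind hind (s := σ ^ 2) (by positivity)
    (fun ω => hO.integrable_gradY (hmem ω).1 _)
    (fun ω => by
      simp only [hO.integral_gradY (hmem ω).1]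
      exact hO.variance_gradY (hmem ω).1 _) hb
  have hmX : Measurable fun ω => ‖batchMean (batch t) (fun i => O.gradX (x t ω) (y t ω) (ξ t i ω))
      - ∫ z, O.gradX (x t ω) (y t ω) z ∂ν‖ₑ ^ 2 :=
    ((measurable_batchMean hO.measurable_gradX hθ' (hξ.measurable t) (batch t)).sub
      ((StronglyMeasurable.integral_prod_right
        hO.measurable_gradX.stronglyMeasurable).measurable.comp hθ')).enorm.pow_const 2
  have hmY : Measurable fun ω => ‖batchMean (batch t) (fun i => O.gradY (x t ω) (y t ω) (ξ t i ω))
      - ∫ z, O.gradY (x t ω) (y t ω) z ∂ν‖ₑ ^ 2 :=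
    ((measurable_batchMean hO.measurable_gradY hθ' (hξ.measurable t) (batch t)).sub
      ((StronglyMeasurable.integral_prod_right
        hO.measurable_gradY.stronglyMeasurable).measurable.comp hθ')).enorm.pow_const 2
  have e : ∀ ω, ENNReal.ofReal (P.gradError (x t ω)
        (batchMean (batch t) (fun i => O.gradX (x t ω) (y t ω) (ξ t i ω))) (y t ω)
        (batchMean (batch t) (fun i => O.gradY (x t ω) (y t ω) (ξ t i ω))))
      = ‖batchMean (batch t) (fun i => O.gradX (x t ω) (y t ω) (ξ t i ω))
          - ∫ z, O.gradX (x t ω) (y t ω) z ∂ν‖ₑ ^ 2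
        + ‖batchMean (batch t) (fun i => O.gradY (x t ω) (y t ω) (ξ t i ω))
          - ∫ z, O.gradY (x t ω) (y t ω) z ∂ν‖ₑ ^ 2 := fun ω => by
    rw [hO.integral_gradX (hmem ω).1, hO.integral_gradY (hmem ω).1, sub_neg_eq_add,
      enorm_sq_eq_ofReal, enorm_sq_eq_ofReal, ← ENNReal.ofReal_add (by positivity) (by positivity)]
    rfl
  simp only [e]
  refine ⟨hmX.add hmY, ?_⟩
  rw [lintegral_add_left hmX]
  refine (add_le_add hX hY).trans_eq ?_
  rw [← ENNReal.ofReal_add (by positivity) (by positivity)]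
  congr 1
  ring

end IsMSPGRun

/-- The weighted sum of the expected squared stationarity measures along a run of MSPG. -/
theorem exists_sum_lintegral_stationarity_sq_le {Lg Gl Ll Dy Lh v c α : ℝ} (M σ B : ℝ)
    (hLg : 0 ≤ Lg) (hGl : 0 ≤ Gl) (hLl : 0 ≤ Ll) (hDy : 0 ≤ Dy) (hLh : 0 ≤ Lh)
    (hL : 0 < jointSmoothness Lg Gl Ll Dy) (hv : 0 < v) (hv1 : v ≤ 1)
    (hc : 0 < c) (hc2 : c < 1 / 2) (hα : 0 ≤ α) {b : ℕ} (hb : 0 < b) :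
    ∃ K : ℝ, 0 ≤ K ∧ ∀ (d m : ℕ) (P : Problem d m), P.Regular Lg Gl Ll Dy Lh v M →
      ∀ (Ξ : Type*) [MeasurableSpace Ξ] (ν : Measure Ξ) [IsProbabilityMeasure ν]
        (O : Oracle d m Ξ), O.IsUnbiased P ν σ →
      ∀ (Ω : Type*) [MeasurableSpace Ω] (μ : Measure Ω) [IsProbabilityMeasure μ]
        (ξ : ℕ → ℕ → Ω → Ξ), IsSampling ξ ν μ →
      ∀ x₁ ∈ P.X, ∀ y₁ ∈ P.domH, stationarity P x₁ ≤ ENNReal.ofReal B →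
      ∀ (T : ℕ), 1 ≤ T → ∀ (x : ℕ → Ω → Vec d) (y : ℕ → Ω → Vec m),
        IsMSPGRun P O (c / jointSmoothness Lg Gl Ll Dy) (fun t => b * t) T ξ x₁ y₁ x y →
        ∑ t ∈ Finset.Icc 1 T, ENNReal.ofReal ((t : ℝ) ^ α) * ∫⁻ ω, stationarity P (x t ω) ^ 2 ∂μ
          ≤ ENNReal.ofReal (K * ((T : ℝ) ^ (α + 1 - v)
            + ∑ t ∈ Finset.Icc 1 T, (t : ℝ) ^ (α + 1 - v - 1))) := by
  obtain ⟨K, hK, H⟩ := exists_sum_stationarity_bound (c := c) (α := α) M hLg hGl hLl hDy hLh hL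
    hv hv1 hc hc2 hα
  have hη : 0 < c / jointSmoothness Lg Gl Ll Dy := div_pos hc hL
  set β := α + 1 - v with hβ
  have hβ0 : 0 ≤ β := by linarith
  set V := 3 * σ ^ 2 + 2 * Dy ^ 2 * σ ^ 2 with hV
  have hV0 : 0 ≤ V := by positivity
  refine ⟨B ^ 2 + K * (1 + 2 * V), by positivity, ?_⟩
  intro d m P hP Ξ _ ν _ O hO Ω _ μ _ ξ hξ x₁ hx₁ y₁ hy₁ hB T hT x y hR
  -- Step `s` controls `x (s + 1)`, so `n = T - 1` steps cover the iterates `2, …, T`; the first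
  -- iterate is covered by `B`.
  obtain ⟨n, rfl⟩ : ∃ n, T = n + 1 := ⟨T - 1, by omega⟩
  have hsub : ∀ {s}, s ∈ Finset.Icc 1 n → s ∈ Finset.Icc 1 (n + 1) := fun hs =>
    Finset.Icc_subset_Icc_right (by omega) hs
  have hmeas : ∀ t ∈ Finset.Icc 1 (n + 1), Measurable fun ω => stationarity P (x t ω) ^ 2 :=
    fun t ht => ((hP.measurable_stationarity hv).comp
      ((hR.measurable_past hP hO hη ht).1.mono (hξ.past_le t) le_rfl)).pow_const 2
  set gx : ℕ → Ω → Vec d := fun t ω => batchMean (b * t)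
    (fun i => O.gradX (x t ω) (y t ω) (ξ t i ω)) with hgx
  set gy : ℕ → Ω → Vec m := fun t ω => batchMean (b * t)
    (fun i => O.gradY (x t ω) (y t ω) (ξ t i ω)) with hgy
  set e : ℕ → Ω → ℝ := fun t ω => P.gradError (x t ω) (gx t ω) (y t ω) (gy t ω) with he
  have he0 : ∀ t ω, 0 ≤ e t ω := fun t ω => P.gradError_nonneg _ _ _ _
  -- The batch size satisfies `b * t ≥ (t + 1) / 2`, whence the factor `2`; the index `t + 1`
  -- matches the shifted weights.
  have hint : ∀ t ∈ Finset.Icc 1 n, Measurable (fun ω => ENNReal.ofReal (e t ω)) ∧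
      ∫⁻ ω, ENNReal.ofReal (e t ω) ∂μ ≤ ENNReal.ofReal (2 * V * (t + 1 : ℝ)⁻¹) := by
    intro t ht
    have ht0 : 0 < t := (Finset.mem_Icc.1 ht).1
    obtain ⟨h1, h2⟩ := hR.lintegral_gradError_le hP hO hξ hη hx₁ hy₁ (hsub ht)
      (Nat.mul_pos hb ht0)
    refine ⟨h1, h2.trans (ENNReal.ofReal_le_ofReal ?_)⟩
    have h3 : (1 : ℝ) ≤ t := by exact_mod_cast ht0
    have h4 : (1 : ℝ) ≤ b := by exact_mod_cast hb
    push_cast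
    rw [← hV, ← div_eq_mul_inv, div_le_div_iff₀ (by positivity) (by positivity)]
    nlinarith [mul_nonneg hV0 (sub_nonneg.2 h3),
      mul_nonneg hV0 (mul_nonneg (sub_nonneg.2 h4) (by linarith : (0 : ℝ) ≤ t))]
  have hpt : ∀ ω, ∑ s ∈ Finset.Icc 1 n,
      ENNReal.ofReal ((s + 1 : ℝ) ^ α) * stationarity P (x (s + 1) ω) ^ 2 ≤
        ENNReal.ofReal (K * ((n + 1 : ℝ) ^ β + ∑ s ∈ Finset.Icc 1 n, (s + 1 : ℝ) ^ (β - 1)))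
          + ∑ s ∈ Finset.Icc 1 n, ENNReal.ofReal (K * (s + 1 : ℝ) ^ β) * ENNReal.ofReal (e s ω) := by
    intro ω
    have h1 := H d m P hP n (fun s => x s ω) (fun s => gx s ω) (fun s => y s ω) (fun s => gy s ω)
      (by simpa only [hR.init_x] using hx₁) (by simpa only [hR.init_y] using hy₁)
      (fun s hs => hR.isStep (hsub hs) ω)
    refine h1.trans_eq ?_
    rw [mul_add, ENNReal.ofReal_add, Finset.mul_sum, ENNReal.ofReal_sum_of_nonneg]
    · congr 1
      refine Finset.sum_congr rfl fun s _ => ?_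
      rw [← mul_assoc, ENNReal.ofReal_mul (by positivity)]
    · exact fun s _ => mul_nonneg hK (mul_nonneg (by positivity) (he0 s ω))
    · positivity
    · exact mul_nonneg hK (Finset.sum_nonneg fun s _ => mul_nonneg (by positivity) (he0 s ω))
  set A := (n + 1 : ℝ) ^ β + ∑ s ∈ Finset.Icc 1 n, (s + 1 : ℝ) ^ (β - 1) with hA
  have hR0 : 0 ≤ ∑ s ∈ Finset.Icc 1 n, (s + 1 : ℝ) ^ (β - 1) :=
    Finset.sum_nonneg fun s _ => by positivity
  have hA1 : 1 ≤ A := by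
    have : (1 : ℝ) ≤ (n + 1 : ℝ) ^ β := Real.one_le_rpow (by simp) hβ0
    linarith
  have hsum : ∑ s ∈ Finset.Icc 1 n, ENNReal.ofReal ((s + 1 : ℝ) ^ α)
      * ∫⁻ ω, stationarity P (x (s + 1) ω) ^ 2 ∂μ ≤ ENNReal.ofReal (K * (1 + 2 * V) * A) := by
    have hs1 : ∀ s ∈ Finset.Icc 1 n, s + 1 ∈ Finset.Icc 1 (n + 1) := fun s hs => by
      have := (Finset.mem_Icc.1 hs).2
      exact Finset.mem_Icc.2 ⟨by omega, by omega⟩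
    calc _ = ∫⁻ ω, ∑ s ∈ Finset.Icc 1 n,
          ENNReal.ofReal ((s + 1 : ℝ) ^ α) * stationarity P (x (s + 1) ω) ^ 2 ∂μ := by
          rw [lintegral_finsetSum _ fun s hs => (hmeas _ (hs1 s hs)).const_mul _]
          exact Finset.sum_congr rfl fun s hs => (lintegral_const_mul _ (hmeas _ (hs1 s hs))).symm
      _ ≤ ∫⁻ ω, (ENNReal.ofReal (K * A) + ∑ s ∈ Finset.Icc 1 n,
            ENNReal.ofReal (K * (s + 1 : ℝ) ^ β) * ENNReal.ofReal (e s ω)) ∂μ := lintegral_mono hpt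
      _ = ENNReal.ofReal (K * A) + ∑ s ∈ Finset.Icc 1 n,
            ENNReal.ofReal (K * (s + 1 : ℝ) ^ β) * ∫⁻ ω, ENNReal.ofReal (e s ω) ∂μ := by
          rw [lintegral_add_left measurable_const, lintegral_const, measure_univ, mul_one,
            lintegral_finsetSum _ fun s hs => (hint s hs).1.const_mul _]
          congr 1
          exact Finset.sum_congr rfl fun s hs => lintegral_const_mul _ (hint s hs).1
      _ ≤ ENNReal.ofReal (K * A) + ∑ s ∈ Finset.Icc 1 n,
            ENNReal.ofReal (K * (2 * V) * (s + 1 : ℝ) ^ (β - 1)) := by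
          gcongr with s hs
          refine (mul_le_mul_right (hint s hs).2 _).trans_eq ?_
          rw [← ENNReal.ofReal_mul (by positivity), Real.rpow_sub_one (by positivity)]
          congr 1
          field_simp
      _ = ENNReal.ofReal (K * A + K * (2 * V) * ∑ s ∈ Finset.Icc 1 n, (s + 1 : ℝ) ^ (β - 1)) := by
          rw [← ENNReal.ofReal_sum_of_nonneg fun s _ => by positivity, ← Finset.mul_sum,
            ← ENNReal.ofReal_add (by positivity) (by positivity)]
      _ ≤ _ := by
          refine ENNReal.ofReal_le_ofReal ?_
          have h1 : ∑ s ∈ Finset.Icc 1 n, (s + 1 : ℝ) ^ (β - 1) ≤ A := by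
            rw [hA]
            have : (0 : ℝ) ≤ (n + 1 : ℝ) ^ β := by positivity
            linarith
          have h2 := mul_le_mul_of_nonneg_left h1 (by positivity : 0 ≤ K * (2 * V))
          linarith
  have hshift {N : Type} [AddCommMonoid N] (φ : ℕ → N) : ∑ t ∈ Finset.Icc 1 (n + 1), φ t
      = φ 1 + ∑ s ∈ Finset.Icc 1 n, φ (s + 1) := by
    rw [← Finset.add_sum_Ioc_eq_sum_Icc (by omega : 1 ≤ n + 1)]
    congr 1
    refine (Finset.sum_bij (fun s _ => s + 1) ?_ ?_ ?_ ?_).symm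
    · intro s hs; simp only [Finset.mem_Icc, Finset.mem_Ioc] at hs ⊢; omega
    · intro s _ s' _ h; omega
    · intro s hs
      simp only [Finset.mem_Ioc] at hs
      exact ⟨s - 1, Finset.mem_Icc.2 (by omega), by omega⟩
    · intro s _; rfl
  rw [hshift, hshift]
  have hfirst : ENNReal.ofReal ((1 : ℝ) ^ α) * ∫⁻ ω, stationarity P (x 1 ω) ^ 2 ∂μ
      ≤ ENNReal.ofReal (B ^ 2) := by
    simp only [hR.init_x, lintegral_const, measure_univ, mul_one, Real.one_rpow,
      ENNReal.ofReal_one, one_mul]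
    rcases le_total 0 B with hB0 | hB0
    · rw [ENNReal.ofReal_pow hB0]
      gcongr
    -- A nonpositive `B` is truncated to `0`, which forces zero stationarity at `x₁`.
    · rw [ENNReal.ofReal_of_nonpos hB0] at hB
      rw [nonpos_iff_eq_zero.1 hB]
      simp
  simp only [Nat.cast_add, Nat.cast_one]
  refine (add_le_add hfirst hsum).trans ?_
  rw [← ENNReal.ofReal_add (by positivity) (by positivity)]
  refine ENNReal.ofReal_le_ofReal ?_
  have e1 : (n + 1 : ℝ) ^ β + ((1 : ℝ) ^ (β - 1) + ∑ s ∈ Finset.Icc 1 n, (s + 1 : ℝ) ^ (β - 1))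
      = A + 1 := by
    rw [hA, Real.one_rpow]; ring
  rw [e1]
  have h1 : 0 ≤ K * (1 + 2 * V) := by positivity
  nlinarith [sq_nonneg B]

/-! ### Power sums, first moments and the iteration count -/

lemma rpow_eq_mul_one_sub_inv_rpow (n : ℕ) (p : ℝ) :
    (n : ℝ) ^ p = (n + 1 : ℝ) ^ p * (1 + -(n + 1 : ℝ)⁻¹) ^ p := by
  have h : (0 : ℝ) < n + 1 := by positivity
  have h1 : (n + 1 : ℝ)⁻¹ ≤ 1 := inv_le_one_of_one_le₀ (by simp)
  rw [← Real.mul_rpow h.le (by linarith)]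
  congr 1
  field_simp
  ring

/-- The inductive step is Bernoulli's inequality in the form `(n + 1) ^ p - n ^ p ≤ p * (n + 1) ^ (p
- 1)` for `p = α + 1 ≥ 1`. -/
lemma rpow_le_sum_rpow {α : ℝ} (hα : 0 ≤ α) (T : ℕ) :
    (T : ℝ) ^ (α + 1) ≤ (α + 1) * ∑ t ∈ Finset.Icc 1 T, (t : ℝ) ^ α := by
  induction T with
  | zero => simp [Real.zero_rpow (by linarith : α + 1 ≠ 0)]
  | succ n ih =>
    rw [Finset.sum_Icc_succ_top (by omega), mul_add]
    push_cast
    have h : (0 : ℝ) < n + 1 := by positivity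
    have h1 : (n + 1 : ℝ)⁻¹ ≤ 1 := inv_le_one_of_one_le₀ (by simp)
    have h2 := one_add_mul_self_le_rpow_one_add (s := -(n + 1 : ℝ)⁻¹) (by linarith)
      (by linarith : 1 ≤ α + 1)
    have h3 := mul_le_mul_of_nonneg_left h2 (by positivity : 0 ≤ (n + 1 : ℝ) ^ (α + 1))
    rw [← rpow_eq_mul_one_sub_inv_rpow] at h3
    have h4 : (n + 1 : ℝ) ^ (α + 1) * (1 + (α + 1) * -(n + 1 : ℝ)⁻¹)
        = (n + 1 : ℝ) ^ (α + 1) - (α + 1) * (n + 1 : ℝ) ^ α := by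
      rw [Real.rpow_add_one h.ne']
      field_simp
      ring
    linarith

lemma sum_rpow_sub_one_le {β : ℝ} (hβ : 0 < β) (T : ℕ) :
    ∑ t ∈ Finset.Icc 1 T, (t : ℝ) ^ (β - 1) ≤ (1 + β⁻¹) * (T : ℝ) ^ β := by
  induction T with
  | zero => simp [Real.zero_rpow hβ.ne']
  | succ n ih =>
    rw [Finset.sum_Icc_succ_top (by omega)]
    push_cast
    have h : (0 : ℝ) < n + 1 := by positivity
    have h1 : (n + 1 : ℝ)⁻¹ ≤ 1 := inv_le_one_of_one_le₀ (by simp)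
    have h0 : 0 < (n + 1 : ℝ)⁻¹ := by positivity
    have hβ' : 0 < β⁻¹ := by positivity
    -- The constant `1 + β⁻¹` serves both regimes, as its inverse is at most `min β 1`: Bernoulli is
    -- used for `β ≤ 1`, monotonicity in the exponent for `β ≥ 1`.
    have hstep : (1 + -(n + 1 : ℝ)⁻¹) ^ β ≤ 1 - (1 + β⁻¹)⁻¹ * (n + 1 : ℝ)⁻¹ := by
      rcases le_total β 1 with hβ1 | hβ1
      · have h2 := rpow_one_add_le_one_add_mul_self (s := -(n + 1 : ℝ)⁻¹) (by linarith)
          hβ.le hβ1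
        have h3 : (1 + β⁻¹)⁻¹ ≤ β := by
          rw [inv_le_comm₀ (by positivity) hβ]; linarith
        nlinarith
      · have h2 : (1 + -(n + 1 : ℝ)⁻¹) ^ β ≤ (1 + -(n + 1 : ℝ)⁻¹) ^ (1 : ℝ) :=
          Real.rpow_le_rpow_of_exponent_ge' (by linarith) (by linarith) zero_le_one hβ1
        rw [Real.rpow_one] at h2
        have h3 : (1 + β⁻¹)⁻¹ ≤ 1 := inv_le_one_of_one_le₀ (by linarith)
        nlinarith
    have h3 := mul_le_mul_of_nonneg_left hstep (by positivity : 0 ≤ (n + 1 : ℝ) ^ β)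
    rw [← rpow_eq_mul_one_sub_inv_rpow] at h3
    have h4 : (1 + β⁻¹) * ((n + 1 : ℝ) ^ β * (1 - (1 + β⁻¹)⁻¹ * (n + 1 : ℝ)⁻¹))
        = (1 + β⁻¹) * (n + 1 : ℝ) ^ β - (n + 1 : ℝ) ^ (β - 1) := by
      rw [Real.rpow_sub_one h.ne']
      have : (1 + β⁻¹) ≠ 0 := by positivity
      field_simp
    have h5 := mul_le_mul_of_nonneg_left h3 (by positivity : 0 ≤ 1 + β⁻¹)
    rw [h4] at h5
    linarith

lemma sum_inv_le_one_add_log (T : ℕ) :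
    ∑ t ∈ Finset.Icc 1 T, (t : ℝ) ^ (-1 : ℝ) ≤ 1 + Real.log T := by
  refine le_trans (le_of_eq ?_) (harmonic_le_one_add_log T)
  rw [harmonic_eq_sum_Icc]
  push_cast
  exact Finset.sum_congr rfl fun t _ => Real.rpow_neg_one _

/-- Either `D ≤ 1 / r` or `r * D ≥ 1`. Unlike Jensen's inequality for the average, this lets `r`
vary with the iterate. -/
lemma ennreal_le_mul_sq_add {r : ℝ} (hr : 0 < r) (D : ℝ≥0∞) :
    D ≤ ENNReal.ofReal r * D ^ 2 + ENNReal.ofReal r⁻¹ := by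
  rcases le_total D (ENNReal.ofReal r⁻¹) with h | h
  · exact h.trans le_add_self
  · refine le_trans ?_ le_self_add
    calc D = ENNReal.ofReal r * ENNReal.ofReal r⁻¹ * D := by
          rw [← ENNReal.ofReal_mul hr.le, mul_inv_cancel₀ hr.ne', ENNReal.ofReal_one, one_mul]
      _ ≤ ENNReal.ofReal r * D * D := by gcongr
      _ = ENNReal.ofReal r * D ^ 2 := by rw [mul_assoc, sq]

/-- A bound of order `T ^ (-v / 2)` falls below `ε` after `O(ε ^ (-2 / v))` iterations, which use
`O(ε ^ (-4 / v))` samples in batches of sizes `b * t`. -/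
lemma exists_iteration_count {C v : ℝ} (hC : 1 ≤ C) (hv : 0 < v) (b : ℕ) :
    ∃ N : ℝ → ℕ, ∀ ε : ℝ, 0 < ε → ε ≤ 1 →
      1 ≤ N ε ∧ (N ε : ℝ) ≤ 2 * C ^ (2 / v) * ε ^ (-(2 / v)) ∧
      ((∑ t ∈ Finset.Icc 1 (N ε), b * t : ℕ) : ℝ)
        ≤ b * (2 * C ^ (2 / v)) ^ 2 * ε ^ (-(4 / v)) ∧
      ∀ T : ℕ, N ε ≤ T → C * (T : ℝ) ^ (-(v / 2)) ≤ ε := by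
  -- This solves `C * T ^ (-(v / 2)) = ε` for `T`. Since `C / ε ≥ 1`, rounding up at most doubles
  -- the value.
  refine ⟨fun ε => ⌈(C / ε) ^ (2 / v)⌉₊, fun ε hε hε1 => ?_⟩
  have hC0 : 0 < C := by linarith
  have hCε : 1 ≤ C / ε := by rw [le_div_iff₀ hε]; linarith
  have hpow : 1 ≤ (C / ε) ^ (2 / v) := Real.one_le_rpow hCε (by positivity)
  have hN1 : 1 ≤ ⌈(C / ε) ^ (2 / v)⌉₊ := Nat.one_le_ceil_iff.2 (by linarith)
  have hN : (⌈(C / ε) ^ (2 / v)⌉₊ : ℝ) ≤ 2 * C ^ (2 / v) * ε ^ (-(2 / v)) := by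
    have h1 := (Nat.ceil_lt_add_one (by linarith : 0 ≤ (C / ε) ^ (2 / v))).le
    have h2 : (C / ε) ^ (2 / v) = C ^ (2 / v) * ε ^ (-(2 / v)) := by
      rw [Real.div_rpow hC0.le hε.le, Real.rpow_neg hε.le, div_eq_mul_inv]
    rw [h2] at h1 hpow
    rw [h2]
    linarith
  refine ⟨hN1, hN, ?_, fun T hT => ?_⟩
  · have h1 : ∑ t ∈ Finset.Icc 1 ⌈(C / ε) ^ (2 / v)⌉₊, b * t
        ≤ ⌈(C / ε) ^ (2 / v)⌉₊ * (b * ⌈(C / ε) ^ (2 / v)⌉₊) := by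
      refine (Finset.sum_le_card_nsmul _ _ (b * ⌈(C / ε) ^ (2 / v)⌉₊) fun t ht =>
        Nat.mul_le_mul_left b (Finset.mem_Icc.1 ht).2).trans_eq ?_
      simp
    have h2 : ((∑ t ∈ Finset.Icc 1 ⌈(C / ε) ^ (2 / v)⌉₊, b * t : ℕ) : ℝ)
        ≤ b * (⌈(C / ε) ^ (2 / v)⌉₊ : ℝ) ^ 2 := by
      refine (Nat.cast_le.2 h1).trans_eq ?_
      push_cast
      ring
    have h3 : ε ^ (-(4 / v)) = (ε ^ (-(2 / v))) ^ 2 := by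
      rw [← Real.rpow_natCast, ← Real.rpow_mul hε.le]
      congr 1
      push_cast
      ring
    rw [h3, mul_assoc, ← mul_pow]
    exact h2.trans (by gcongr)
  · have hT' : (C / ε) ^ (2 / v) ≤ T := (Nat.le_ceil _).trans (by exact_mod_cast hT)
    have hT0 : (0 : ℝ) < T := by linarith
    have h1 := Real.rpow_le_rpow (by positivity) hT' (by positivity : 0 ≤ v / 2)
    rw [← Real.rpow_mul (by positivity), div_mul_div_cancel₀ hv.ne', div_self two_ne_zero,
      Real.rpow_one, div_le_iff₀ hε] at h1
    rw [Real.rpow_neg hT0.le, ← div_eq_mul_inv, div_le_iff₀ (by positivity)]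
    linarith

end InfProj

/-! ### Assembly of the rates and the complexity bound -/

theorem theorem1
    (Lg Gl Ll Dy Lh v M σ B c α : ℝ) (b : ℕ)
    (hLg : 0 ≤ Lg) (hGl : 0 ≤ Gl) (hLl : 0 ≤ Ll) (hDy : 0 ≤ Dy) (hLh : 0 < Lh)
    (hL : 0 < InfProj.jointSmoothness Lg Gl Ll Dy)
    (hv : 0 < v) (hv1 : v ≤ 1) (hc : 0 < c) (hc2 : c < 1 / 2) (hα : 0 ≤ α) (hb : 0 < b) :
    ∃ C : ℝ, 0 < C ∧ ∃ N : ℝ → ℕ,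
      (∀ ε : ℝ, 0 < ε → ε ≤ 1 →
        1 ≤ N ε ∧ (N ε : ℝ) ≤ C * ε ^ (-(2 / v)) ∧
        ((∑ t ∈ Finset.Icc 1 (N ε), b * t : ℕ) : ℝ) ≤ C * ε ^ (-(4 / v))) ∧
      ∀ (d m : ℕ) (P : InfProj.Problem d m), P.Regular Lg Gl Ll Dy Lh v M →
      ∀ (Ξ : Type*) [MeasurableSpace Ξ] (ν : Measure Ξ) [IsProbabilityMeasure ν]
        (O : InfProj.Oracle d m Ξ), O.IsUnbiased P ν σ →
      ∀ (Ω : Type*) [MeasurableSpace Ω] (μ : Measure Ω) [IsProbabilityMeasure μ]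
        (ξ : ℕ → ℕ → Ω → Ξ), InfProj.IsSampling ξ ν μ →
      ∀ x₁ ∈ P.X, ∀ y₁ ∈ P.domH, InfProj.stationarity P x₁ ≤ ENNReal.ofReal B →
      ∀ (T : ℕ), 1 ≤ T → ∀ (x : ℕ → Ω → InfProj.Vec d) (y : ℕ → Ω → InfProj.Vec m),
        InfProj.IsMSPGRun P O (c / InfProj.jointSmoothness Lg Gl Ll Dy) (fun t => b * t) T
          ξ x₁ y₁ x y →
      ∀ τ : Ω → ℕ, InfProj.IsOutputIndex τ α T ξ μ →
        AEMeasurable (fun ω => InfProj.stationarity P (x (τ ω) ω)) μ ∧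
        (v < 1 ∨ 0 < α →
          ∫⁻ ω, InfProj.stationarity P (x (τ ω) ω) ^ 2 ∂μ ≤ ENNReal.ofReal (C / (T : ℝ) ^ v)) ∧
        (v = 1 ∧ α = 0 →
          ∫⁻ ω, InfProj.stationarity P (x (τ ω) ω) ^ 2 ∂μ
            ≤ ENNReal.ofReal (C * (1 + Real.log T) / T)) ∧
        (∀ ε : ℝ, 0 < ε → ε ≤ 1 → N ε ≤ T →
          ∫⁻ ω, InfProj.stationarity P (x (τ ω) ω) ∂μ ≤ ENNReal.ofReal ε) := by
  obtain ⟨K, hK, H⟩ := InfProj.exists_sum_lintegral_stationarity_sq_le (c := c) (α := α) M σ B hLg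
    hGl hLl hDy hLh.le hL hv hv1 hc hc2 hα hb
  -- The weighted bound concerns the run and not `τ`, so a second exponent is available for the
  -- logarithmic case.
  obtain ⟨K', hK', H'⟩ := InfProj.exists_sum_lintegral_stationarity_sq_le (c := c) (α := 1 / 2)
    M σ B hLg hGl hLl hDy hLh.le hL hv hv1 hc hc2 (by norm_num) hb
  set β := α + 1 - v with hβ
  have hβ0 : 0 ≤ β := by linarith
  set C₁ := (α + 1) * (K * (2 + β⁻¹)) with hC₁
  have hC₁0 : 0 ≤ C₁ := by positivity
  -- This dominates both first-moment constants, `C₁ + 1` and `4 * K' + 3`, and is at least `1` as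
  -- the iteration count requires.
  set C₂ := C₁ + 4 * K' + 4 with hC₂
  obtain ⟨N, hN⟩ := InfProj.exists_iteration_count (C := C₂) (by linarith) hv b
  have hC₂0 : 0 ≤ C₂ := by positivity
  set C := C₁ + 2 * C₂ ^ (2 / v) + b * (2 * C₂ ^ (2 / v)) ^ 2 + 1 with hC
  have hp1 : 0 ≤ 2 * C₂ ^ (2 / v) := by positivity
  have hp2 : 0 ≤ b * (2 * C₂ ^ (2 / v)) ^ 2 := by positivity
  refine ⟨C, by linarith, N, fun ε hε hε1 => ⟨(hN ε hε hε1).1, (hN ε hε hε1).2.1.trans ?_,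
    (hN ε hε hε1).2.2.1.trans ?_⟩, ?_⟩
  · exact mul_le_mul_of_nonneg_right (by linarith) (by positivity)
  · exact mul_le_mul_of_nonneg_right (by linarith) (by positivity)
  intro d m P hP Ξ _ ν _ O hO Ω _ μ _ ξ hξ x₁ hx₁ y₁ hy₁ hB T hT x y hR τ hτ
  have hT1 : (1 : ℝ) ≤ T := by exact_mod_cast hT
  have hT0 : (0 : ℝ) < T := by linarith
  have hη : 0 < c / InfProj.jointSmoothness Lg Gl Ll Dy := div_pos hc hL
  set D : ℕ → Ω → ℝ≥0∞ := fun t ω => InfProj.stationarity P (x t ω)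
  have hDpast : ∀ t ∈ Finset.Icc 1 T, Measurable[InfProj.past ξ t] (D t) := fun t ht =>
    (hP.measurable_stationarity hv).comp (hR.measurable_past hP hO hη ht).1
  have hDmeas : ∀ t ∈ Finset.Icc 1 T, Measurable (D t) := fun t ht =>
    (hDpast t ht).mono (hξ.past_le t) le_rfl
  obtain ⟨hm1, he1⟩ := hτ.lintegral_eq hξ hDpast
  obtain ⟨-, he2⟩ := hτ.lintegral_eq hξ (φ := fun t ω => D t ω ^ 2) fun t ht =>
    (hDpast t ht).pow_const 2
  set A := ∑ s ∈ Finset.Icc 1 T, (s : ℝ) ^ α with hA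
  have hAT := InfProj.rpow_le_sum_rpow hα T
  rw [← hA] at hAT
  have hA0 : 0 < A := by
    have : 0 < (T : ℝ) ^ (α + 1) := by positivity
    exact pos_of_mul_pos_right (this.trans_le hAT) (by positivity)
  have hAinv : A⁻¹ ≤ (α + 1) * ((T : ℝ) ^ (α + 1))⁻¹ := by
    rw [← div_eq_mul_inv, le_div_iff₀ (by positivity), ← div_eq_inv_mul, div_le_iff₀ hA0]
    exact hAT
  have hweight : ∀ I : ℕ → ℝ≥0∞,
      ∑ t ∈ Finset.Icc 1 T, ENNReal.ofReal ((t : ℝ) ^ α / A) * I t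
        = ENNReal.ofReal A⁻¹ * ∑ t ∈ Finset.Icc 1 T, ENNReal.ofReal ((t : ℝ) ^ α) * I t := by
    intro I
    rw [Finset.mul_sum]
    refine Finset.sum_congr rfl fun t _ => ?_
    rw [div_eq_inv_mul, ENNReal.ofReal_mul (by positivity), mul_assoc]
  have hsq : ∫⁻ ω, D (τ ω) ω ^ 2 ∂μ ≤ ENNReal.ofReal ((α + 1) * ((T : ℝ) ^ (α + 1))⁻¹
      * (K * ((T : ℝ) ^ β + ∑ t ∈ Finset.Icc 1 T, (t : ℝ) ^ (β - 1)))) := by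
    rw [he2, hweight, ENNReal.ofReal_mul (by positivity)]
    exact mul_le_mul' (ENNReal.ofReal_le_ofReal hAinv)
      (H d m P hP Ξ ν O hO Ω μ ξ hξ x₁ hx₁ y₁ hy₁ hB T hT x y hR)
  have hfast : v < 1 ∨ 0 < α →
      ∫⁻ ω, D (τ ω) ω ^ 2 ∂μ ≤ ENNReal.ofReal (C₁ * (T : ℝ) ^ (-v)) := by
    intro hcase
    have hβpos : 0 < β := by rcases hcase with h | h <;> linarith
    refine hsq.trans (ENNReal.ofReal_le_ofReal ?_)
    have h1 := InfProj.sum_rpow_sub_one_le hβpos T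
    calc (α + 1) * ((T : ℝ) ^ (α + 1))⁻¹
          * (K * ((T : ℝ) ^ β + ∑ t ∈ Finset.Icc 1 T, (t : ℝ) ^ (β - 1)))
        ≤ (α + 1) * ((T : ℝ) ^ (α + 1))⁻¹ * (K * ((T : ℝ) ^ β + (1 + β⁻¹) * (T : ℝ) ^ β)) := by
          gcongr
      _ = C₁ * (((T : ℝ) ^ (α + 1))⁻¹ * (T : ℝ) ^ β) := by rw [hC₁]; ring
      _ = C₁ * (T : ℝ) ^ (-v) := by
          rw [← Real.rpow_neg hT0.le, ← Real.rpow_add hT0]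
          congr 2
          rw [hβ]; ring
  have hfirst : ∫⁻ ω, D (τ ω) ω ∂μ ≤ ENNReal.ofReal (C₂ * (T : ℝ) ^ (-(v / 2))) := by
    by_cases hcase : v < 1 ∨ 0 < α
    -- The choice `r = T ^ (v / 2)` balances a second moment of order `T ^ (-v)` against `1 / r`.
    · have hTv : (0 : ℝ) < (T : ℝ) ^ (v / 2) := by positivity
      calc ∫⁻ ω, D (τ ω) ω ∂μ
          ≤ ∫⁻ ω, (ENNReal.ofReal ((T : ℝ) ^ (v / 2)) * D (τ ω) ω ^ 2
              + ENNReal.ofReal ((T : ℝ) ^ (v / 2))⁻¹) ∂μ :=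
            lintegral_mono fun ω => InfProj.ennreal_le_mul_sq_add hTv _
        _ = ENNReal.ofReal ((T : ℝ) ^ (v / 2)) * ∫⁻ ω, D (τ ω) ω ^ 2 ∂μ
              + ENNReal.ofReal ((T : ℝ) ^ (v / 2))⁻¹ := by
            rw [lintegral_add_right _ measurable_const, lintegral_const_mul _ (hm1.pow_const 2),
              lintegral_const, measure_univ, mul_one]
        _ ≤ ENNReal.ofReal ((T : ℝ) ^ (v / 2)) * ENNReal.ofReal (C₁ * (T : ℝ) ^ (-v))
              + ENNReal.ofReal ((T : ℝ) ^ (v / 2))⁻¹ := by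
            gcongr
            exact hfast hcase
        _ = ENNReal.ofReal ((C₁ + 1) * (T : ℝ) ^ (-(v / 2))) := by
            rw [← ENNReal.ofReal_mul hTv.le, ← ENNReal.ofReal_add (by positivity) (by positivity)]
            congr 1
            have h1 : (T : ℝ) ^ (v / 2) * (T : ℝ) ^ (-v) = (T : ℝ) ^ (-(v / 2)) := by
              rw [← Real.rpow_add hT0]; congr 1; ring
            rw [← Real.rpow_neg hT0.le, add_mul, one_mul, ← h1]
            ring
        _ ≤ _ := ENNReal.ofReal_le_ofReal
            (mul_le_mul_of_nonneg_right (by linarith) (by positivity))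
    · rw [not_or, not_lt, not_lt] at hcase
      obtain rfl : v = 1 := le_antisymm hv1 hcase.1
      obtain rfl : α = 0 := le_antisymm hcase.2 hα
      -- For `v = 1` and weights `t ^ (1 / 2)` the right side is of order `T ^ (1 / 2)`; with `r = t
      -- ^ (1 / 2)` in the `t`-th term the first moments sum to the same order, and the uniform
      -- average is `O(T ^ (-1 / 2))`.
      have h1 := H' d m P hP Ξ ν O hO Ω μ ξ hξ x₁ hx₁ y₁ hy₁ hB T hT x y hR
      rw [add_sub_cancel_right] at h1
      have h2 := InfProj.sum_rpow_sub_one_le (β := 1 / 2) (by norm_num) T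
      have hT2 : (0 : ℝ) < (T : ℝ) ^ (1 / 2 : ℝ) := by positivity
      have hterm : ∀ t ∈ Finset.Icc 1 T, ∫⁻ ω, D t ω ∂μ
          ≤ ENNReal.ofReal ((t : ℝ) ^ (1 / 2 : ℝ)) * ∫⁻ ω, D t ω ^ 2 ∂μ
            + ENNReal.ofReal ((t : ℝ) ^ (1 / 2 - 1 : ℝ)) := by
        intro t ht
        have ht0 : (0 : ℝ) < t := by exact_mod_cast (Finset.mem_Icc.1 ht).1
        calc ∫⁻ ω, D t ω ∂μ ≤ ∫⁻ ω, (ENNReal.ofReal ((t : ℝ) ^ (1 / 2 : ℝ)) * D t ω ^ 2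
              + ENNReal.ofReal ((t : ℝ) ^ (1 / 2 : ℝ))⁻¹) ∂μ :=
            lintegral_mono fun ω => InfProj.ennreal_le_mul_sq_add (by positivity) _
          _ = _ := by
            rw [lintegral_add_right _ measurable_const,
              lintegral_const_mul _ ((hDmeas t ht).pow_const 2), lintegral_const, measure_univ,
              mul_one, ← Real.rpow_neg ht0.le]
            norm_num
      rw [he1, hweight]
      calc ENNReal.ofReal A⁻¹ * ∑ t ∈ Finset.Icc 1 T,
            ENNReal.ofReal ((t : ℝ) ^ (0 : ℝ)) * ∫⁻ ω, D t ω ∂μ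
          ≤ ENNReal.ofReal (T : ℝ)⁻¹ * ENNReal.ofReal ((4 * K' + 3) * (T : ℝ) ^ (1 / 2 : ℝ)) := by
            refine mul_le_mul' (ENNReal.ofReal_le_ofReal ?_) ?_
            · simpa using hAinv
            · simp only [Real.rpow_zero, ENNReal.ofReal_one, one_mul]
              refine (Finset.sum_le_sum hterm).trans ?_
              rw [Finset.sum_add_distrib,
                ← ENNReal.ofReal_sum_of_nonneg fun t _ => by positivity]
              refine (add_le_add h1 le_rfl).trans ?_
              rw [← ENNReal.ofReal_add (by positivity) (by positivity)]
              refine ENNReal.ofReal_le_ofReal ?_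
              have h3 : ∑ t ∈ Finset.Icc 1 T, (t : ℝ) ^ (1 / 2 - 1 : ℝ)
                  ≤ 3 * (T : ℝ) ^ (1 / 2 : ℝ) := by
                refine h2.trans_eq ?_
                norm_num
              have h4 := mul_le_mul_of_nonneg_left h3 hK'
              linarith
        _ = ENNReal.ofReal ((4 * K' + 3) * (T : ℝ) ^ (-(1 / 2 : ℝ))) := by
            rw [← ENNReal.ofReal_mul (by positivity)]
            congr 1
            have h5 : (T : ℝ)⁻¹ * (T : ℝ) ^ (1 / 2 : ℝ) = (T : ℝ) ^ (-(1 / 2 : ℝ)) := by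
              rw [← Real.rpow_neg_one, ← Real.rpow_add hT0]; norm_num
            rw [← h5]; ring
        _ ≤ _ := ENNReal.ofReal_le_ofReal
            (mul_le_mul_of_nonneg_right (by linarith) (by positivity))
  refine ⟨hm1.aemeasurable, fun hcase => (hfast hcase).trans (ENNReal.ofReal_le_ofReal ?_),
    fun hcase => hsq.trans (ENNReal.ofReal_le_ofReal ?_),
    fun ε hε hε1 hNT => hfirst.trans (ENNReal.ofReal_le_ofReal ((hN ε hε hε1).2.2.2 T hNT))⟩
  · rw [Real.rpow_neg hT0.le, ← div_eq_mul_inv]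
    gcongr
    linarith
  · obtain ⟨rfl, rfl⟩ := hcase
    have hlog : 0 ≤ Real.log T := Real.log_nonneg hT1
    have hβz : β = 0 := by rw [hβ]; ring
    have h1 := InfProj.sum_inv_le_one_add_log T
    -- Here `β = 0`, and the convention `0⁻¹ = 0` makes `C₁` equal to `2 * K`.
    have hCK : 2 * K ≤ C := by
      have : C₁ = 2 * K := by rw [hC₁, hβz]; norm_num; ring
      linarith
    rw [hβz, Real.rpow_zero, zero_add, Real.rpow_one, one_mul, zero_sub, div_eq_inv_mul]
    refine mul_le_mul_of_nonneg_left ?_ (by positivity)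
    calc K * (1 + ∑ t ∈ Finset.Icc 1 T, (t : ℝ) ^ (-1 : ℝ))
        ≤ K * (1 + (1 + Real.log T)) := by gcongr
      _ ≤ 2 * K * (1 + Real.log T) := by nlinarith
      _ ≤ C * (1 + Real.log T) := by gcongr
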